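/- Rings are associative but not necessarily unital. An involution on a ring $R$ is an additive map $x\mapsto x^*$ with $(x^*)^*=x$ and $(xy)^*=y^*x^*$; a ring with an involution is a $*$-ring. In a $*$-ring write $x\ge 0$ if $x$ is a finite sum of elements $yy^*$, and $x>0$ if moreover $x\ne 0$. The involution is positive definite if $\sum_{i=1}^n x_ix_i^*=0$ implies that all $x_i=0$. A trace is an additive map $t:R\to T$ of rings with $t(xy)=t(yx)$ for all $x,y\in R$; it is minimal if $t(x)=0$ implies that $x$ lies in the additive subgroup $[R,R]$ generated by the commutators $xy-yx$; a trace between $*$-rings is faithful if $x>0$ implies $t(x)>0$. A (directed) graph $E=(E^0,E^1,\mathbf s,\mathbf r)$ consists of sets $E^0$ (vertices) and $E^1$ (edges) and maps $\mathbf s,\mathbf r:E^1\to E^0$. It is row-finite if every vertex is the source of only finitely many edges. A cycle is a sequence $e_1\cdots e_n$ of edges, $n\ge 1$, with $\mathbf r(e_i)=\mathbf s(e_{i+1})$ for $i<n$, $\mathbf r(e_n)=\mathbf s(e_1)$ and pairwise distinct $\mathbf s(e_i)$. An exit of a finite or infinite path $e_1e_2\cdots$ is an edge $e$ such that $\mathbf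 s(e)=\mathbf s(e_i)$ and $e\ne e_i$ for some $i$. The graph is a no-exit graph if no cycle has an exit. An infinite path is a sequence $e_1e_2\cdots$ of edges with $\mathbf r(e_i)=\mathbf s(e_{i+1})$ for all $i$; it ends in a sink if some tail $e_ne_{n+1}\cdots$ contains no cycle and has no exit, and it ends in a cycle if some tail equals $ccc\cdots$ for a cycle $c$. For a field $K$, the Leavitt path algebra $L_K(E)$ is the $K$-algebra generated by the symbols $v$ ($v\in E^0$) and $e,e^*$ ($e\in E^1$) subject to $vw=\delta_{v,w}v$, $\mathbf s(e)e=e\mathbf r(e)=e$, $\mathbf r(e)e^*=e^*\mathbf s(e)=e^*$, $e^*f=\delta_{e,f}\mathbf r(e)$, and $v=\sum_{\mathbf s(e)=v}ee^*$ for every vertex $v$ that is the source of at least one and only finitely many edges. If $K$ has an involution, $L_K(E)$ carries the involution that extends it semilinearly, fixes each $v$, and interchanges $e$ and $e^*$. **Theorem.** Let $K$ be a field with a positive definite involution, and let $E$ be a row-finite graph in which every infinite path ends either in a sink or in a cycle. Then the following are equivalent. (1) There is a faithful $K$-linear trace $t:L_K(E)\to K$. (2) There is a faithful $K$-linear trace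 $t:L_K(E)\to R$ for some $K$-algebra $R$ with an involution. (3) There is a faithful $K$-linear minimal trace $t:L_K(E)\to R$ for some $K$-algebra $R$ with an involution. (4) There is a faithful minimal trace $t:L_K(E)\to R$ for some $*$-ring $R$. (5) There is a faithful trace $t:L_K(E)\to R$ for some $*$-ring $R$. (6) $E$ is a no-exit graph. -/

import Mathlib

universe u v w z

/-! ### Directed graphs -/

/-- A directed graph with vertex set `V` and edge set `E`; loops and parallel edges are allowed. -/
structure DirGraph (V : Type*) (E : Type*) where
  /-- the source of an edge -/
  source : E → V
  /-- the range of an edge -/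
  range : E → V

namespace DirGraph

/-- Every vertex emits only finitely many edges. -/
def RowFinite {V E : Type*} (G : DirGraph V E) : Prop :=
  ∀ v : V, {e : E | G.source e = v}.Finite

/-- A vertex is regular if it emits at least one and only finitely many edges. -/
def IsRegular {V E : Type*} (G : DirGraph V E) (v : V) : Prop :=
  {e : E | G.source e = v}.Finite ∧ {e : E | G.source e = v}.Nonempty

/-- The list `e₁, …, eₙ` of edges is a cycle of positive length: `r(eᵢ) = s(eᵢ₊₁)`,
`r(eₙ) = s(e₁)`, and the sources `s(eᵢ)` are pairwise distinct. -/
def IsCycle {V E : Type*} (G : DirGraph V E) (p : List E) : Prop :=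
  p.IsChain (fun e f => G.range e = G.source f) ∧
    (∃ h : p ≠ [], G.range (p.getLast h) = G.source (p.head h)) ∧
    (p.map G.source).Nodup

/-- The edge `e` is an exit for the path `p = e₁ ⋯ eₙ`: for some `i`, `s(e) = s(eᵢ)` and
`e ≠ eᵢ`. -/
def IsExit {V E : Type*} (G : DirGraph V E) (p : List E) (e : E) : Prop :=
  ∃ f ∈ p, G.source e = G.source f ∧ e ≠ f

/-- No cycle has an exit. -/
def NoExit {V E : Type*} (G : DirGraph V E) : Prop :=
  ∀ p : List E, G.IsCycle p → ∀ e : E, ¬ G.IsExit p e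

/-- An infinite path is a sequence of edges `f 0, f 1, …` with `r(f i) = s(f (i + 1))`. -/
def IsInfinitePath {V E : Type*} (G : DirGraph V E) (f : ℕ → E) : Prop :=
  ∀ i, G.range (f i) = G.source (f (i + 1))

/-- An infinite path is an infinite sink if it contains no cycle and has no exit. -/
def IsInfiniteSink {V E : Type*} (G : DirGraph V E) (f : ℕ → E) : Prop :=
  G.IsInfinitePath f ∧
    (∀ i l : ℕ, ¬ G.IsCycle ((List.range l).map fun j => f (i + j))) ∧
    (∀ (i : ℕ) (e : E), G.source e = G.source (f i) → e = f i)

/-- Some tail of the infinite path is an infinite sink. -/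
def EndsInSink {V E : Type*} (G : DirGraph V E) (f : ℕ → E) : Prop :=
  ∃ n : ℕ, G.IsInfiniteSink fun i => f (n + i)

/-- Some tail of the infinite path is `p p p ⋯` for a cycle `p`. -/
def EndsInCycle {V E : Type*} (G : DirGraph V E) (f : ℕ → E) : Prop :=
  ∃ (n : ℕ) (p : List E), G.IsCycle p ∧ ∀ i : ℕ, p[i % p.length]? = some (f (n + i))

end DirGraph

/-! ### The Leavitt path algebra, by generators and relations

`L_K(G)` is the free (non-unital, associative) `K`-algebra on the symbols `v`, `e`, `e*`,
modulo the smallest ideal that contains the defining relations. -/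

namespace LPA

/-- The generating symbols: vertices `v`, edges `e` and ghost edges `e*`. -/
inductive Gen (V : Type*) (E : Type*) where
  | vertex (v : V) : Gen V E
  | edge (e : E) : Gen V E
  | ghost (e : E) : Gen V E

/-- `v* = v`, and `e` and `e*` are interchanged. -/
def Gen.conj {V E : Type*} : Gen V E → Gen V E
  | .vertex v => .vertex v
  | .edge e => .ghost e
  | .ghost e => .edge e

/-- The free non-unital associative `K`-algebra on the generating symbols. -/
abbrev FreeAlg (K : Type*) [Field K] (V : Type*) (E : Type*) : Type _ :=
  MonoidAlgebra K (FreeSemigroup (Gen V E))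

/-- A generating symbol as an element of the free algebra. -/
noncomputable def gen (K : Type*) [Field K] {V E : Type*} (x : Gen V E) : FreeAlg K V E :=
  MonoidAlgebra.single (FreeSemigroup.of x) 1

/-- The defining relations of the Leavitt path algebra. -/
inductive DefRel (K : Type*) [Field K] {V E : Type*} (G : DirGraph V E) :
    FreeAlg K V E → FreeAlg K V E → Prop
  | v_same (v : V) : DefRel K G (gen K (.vertex v) * gen K (.vertex v)) (gen K (.vertex v))
  | v_diff (v w : V) : v ≠ w → DefRel K G (gen K (.vertex v) * gen K (.vertex w)) 0
  | e1_source (e : E) :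
      DefRel K G (gen K (.vertex (G.source e)) * gen K (.edge e)) (gen K (.edge e))
  | e1_range (e : E) :
      DefRel K G (gen K (.edge e) * gen K (.vertex (G.range e))) (gen K (.edge e))
  | e2_range (e : E) :
      DefRel K G (gen K (.vertex (G.range e)) * gen K (.ghost e)) (gen K (.ghost e))
  | e2_source (e : E) :
      DefRel K G (gen K (.ghost e) * gen K (.vertex (G.source e))) (gen K (.ghost e))
  | ck1_same (e : E) :
      DefRel K G (gen K (.ghost e) * gen K (.edge e)) (gen K (.vertex (G.range e)))
  | ck1_diff (e f : E) : e ≠ f → DefRel K G (gen K (.ghost e) * gen K (.edge f)) 0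
  | ck2 (v : V) (h : G.IsRegular v) :
      DefRel K G (gen K (.vertex v))
        (∑ e ∈ h.1.toFinset, gen K (.edge e) * gen K (.ghost e))

/-- The smallest ring congruence containing all scalar multiples of the defining relations,
which is the smallest congruence of `K`-algebras containing the defining relations. -/
noncomputable def con (K : Type*) [Field K] {V E : Type*} (G : DirGraph V E) : RingCon (FreeAlg K V E) :=
  ringConGen fun x y => ∃ (k : K) (a b : FreeAlg K V E), DefRel K G a b ∧ x = k • a ∧ y = k • b

theorem con_smul (K : Type*) [Field K] {V E : Type*} (G : DirGraph V E) (k : K)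
    {x y : FreeAlg K V E} (h : con K G x y) : con K G (k • x) (k • y) := by
  change RingConGen.Rel _ x y at h
  induction h with
  | of x y hxy =>
    obtain ⟨l, a, b, hab, rfl, rfl⟩ := hxy
    exact RingConGen.Rel.of _ _ ⟨k * l, a, b, hab, by rw [mul_smul], by rw [mul_smul]⟩
  | refl x => exact RingConGen.Rel.refl _
  | symm _ ih => exact RingConGen.Rel.symm ih
  | trans _ _ ih₁ ih₂ => exact RingConGen.Rel.trans ih₁ ih₂
  | add _ _ ih₁ ih₂ => rw [smul_add, smul_add]; exact RingConGen.Rel.add ih₁ ih₂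
  | mul _ h₂ ih₁ _ =>
    rw [← smul_mul_assoc, ← smul_mul_assoc]; exact RingConGen.Rel.mul ih₁ h₂

/-- The involution on words: reverse the word and conjugate every letter. -/
def wordStar {V E : Type*} (w : FreeSemigroup (Gen V E)) : FreeSemigroup (Gen V E) :=
  MulOpposite.unop (FreeSemigroup.lift (fun x => MulOpposite.op (FreeSemigroup.of x.conj)) w)

theorem wordStar_of {V E : Type*} (x : Gen V E) :
    wordStar (FreeSemigroup.of x) = FreeSemigroup.of x.conj := by
  simp [wordStar]

theorem wordStar_mul {V E : Type*} (a b : FreeSemigroup (Gen V E)) :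
    wordStar (a * b) = wordStar b * wordStar a := by
  simp [wordStar]

theorem wordStar_wordStar {V E : Type*} (a : FreeSemigroup (Gen V E)) :
    wordStar (wordStar a) = a := by
  induction a using FreeSemigroup.recOnMul with
  | ih1 x => rw [wordStar_of, wordStar_of]; cases x <;> rfl
  | ih2 x y hx hy => rw [wordStar_mul, wordStar_mul, hx, hy]

/-- The involution `∑ kᵢ wᵢ ↦ ∑ kᵢ* wᵢ*` of the free algebra. -/
noncomputable def freeStar (K : Type*) [Field K] [StarRing K] (V E : Type*) :
    FreeAlg K V E →+ FreeAlg K V E :=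
  (Finsupp.liftAddHom fun w : FreeSemigroup (Gen V E) =>
    (MonoidAlgebra.singleAddHom (wordStar w)).comp (starAddEquiv : K ≃+ K).toAddMonoidHom).comp
    MonoidAlgebra.coeffAddEquiv.toAddMonoidHom

theorem freeStar_single (K : Type*) [Field K] [StarRing K] {V E : Type*}
    (w : FreeSemigroup (Gen V E)) (k : K) :
    freeStar K V E (MonoidAlgebra.single w k) = MonoidAlgebra.single (wordStar w) (star k) := by
  simp [freeStar]

theorem freeStar_freeStar (K : Type*) [Field K] [StarRing K] {V E : Type*}
    (x : FreeAlg K V E) : freeStar K V E (freeStar K V E x) = x := by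
  have : (freeStar K V E).comp (freeStar K V E) = AddMonoidHom.id _ := by
    refine MonoidAlgebra.addMonoidHom_ext fun w k => ?_
    simp [freeStar_single, wordStar_wordStar]
  exact DFunLike.congr_fun this x

theorem freeStar_mul (K : Type*) [Field K] [StarRing K] {V E : Type*}
    (x y : FreeAlg K V E) :
    freeStar K V E (x * y) = freeStar K V E y * freeStar K V E x := by
  have : (AddMonoidHom.mul (R := FreeAlg K V E)).compr₂ (freeStar K V E) =
      ((AddMonoidHom.mul (R := FreeAlg K V E)).flip.comp (freeStar K V E)).compl₂
        (freeStar K V E) := by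
    refine MonoidAlgebra.addMonoidHom_ext fun w k => ?_
    refine MonoidAlgebra.addMonoidHom_ext fun w' k' => ?_
    simp [freeStar_single, wordStar_mul, MonoidAlgebra.single_mul_single, mul_comm]
  exact DFunLike.congr_fun (DFunLike.congr_fun this x) y

theorem freeStar_smul (K : Type*) [Field K] [StarRing K] {V E : Type*}
    (k : K) (x : FreeAlg K V E) :
    freeStar K V E (k • x) = star k • freeStar K V E x := by
  have : (freeStar K V E).comp (DistribSMul.toAddMonoidHom _ k) =
      (DistribSMul.toAddMonoidHom _ (star k)).comp (freeStar K V E) := by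
    refine MonoidAlgebra.addMonoidHom_ext fun w l => ?_
    simp [freeStar_single]
  exact DFunLike.congr_fun this x

theorem freeStar_gen (K : Type*) [Field K] [StarRing K] {V E : Type*} (x : Gen V E) :
    freeStar K V E (gen K x) = gen K x.conj := by
  simp [gen, freeStar_single, wordStar_of]

theorem defRel_star (K : Type*) [Field K] [StarRing K] {V E : Type*} (G : DirGraph V E)
    {x y : FreeAlg K V E} (h : DefRel K G x y) :
    DefRel K G (freeStar K V E x) (freeStar K V E y) := by
  induction h with
  | v_same v => rw [freeStar_mul, freeStar_gen]; exact .v_same v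
  | v_diff v w h =>
    rw [freeStar_mul, freeStar_gen, freeStar_gen, map_zero]; exact .v_diff w v h.symm
  | e1_source e => rw [freeStar_mul, freeStar_gen, freeStar_gen]; exact .e2_source e
  | e1_range e => rw [freeStar_mul, freeStar_gen, freeStar_gen]; exact .e2_range e
  | e2_range e => rw [freeStar_mul, freeStar_gen, freeStar_gen]; exact .e1_range e
  | e2_source e => rw [freeStar_mul, freeStar_gen, freeStar_gen]; exact .e1_source e
  | ck1_same e =>
    rw [freeStar_mul, freeStar_gen, freeStar_gen, freeStar_gen]; exact .ck1_same e
  | ck1_diff e f h =>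
    rw [freeStar_mul, freeStar_gen, freeStar_gen, map_zero]; exact .ck1_diff f e h.symm
  | ck2 v h =>
    rw [freeStar_gen, map_sum]
    simp_rw [freeStar_mul, freeStar_gen]
    exact .ck2 v h

theorem con_star (K : Type*) [Field K] [StarRing K] {V E : Type*} (G : DirGraph V E)
    {x y : FreeAlg K V E} (h : con K G x y) :
    con K G (freeStar K V E x) (freeStar K V E y) := by
  change RingConGen.Rel _ x y at h
  induction h with
  | of x y hxy =>
    obtain ⟨k, a, b, hab, rfl, rfl⟩ := hxy
    refine RingConGen.Rel.of _ _ ⟨star k, _, _, ?_, freeStar_smul K k a, freeStar_smul K k b⟩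
    exact defRel_star K G hab
  | refl x => exact RingConGen.Rel.refl _
  | symm _ ih => exact RingConGen.Rel.symm ih
  | trans _ _ ih₁ ih₂ => exact RingConGen.Rel.trans ih₁ ih₂
  | add _ _ ih₁ ih₂ =>
    rw [(freeStar K V E).map_add, (freeStar K V E).map_add]
    exact RingConGen.Rel.add ih₁ ih₂
  | mul _ _ ih₁ ih₂ =>
    rw [freeStar_mul, freeStar_mul]; exact RingConGen.Rel.mul ih₂ ih₁

end LPA

/-- The Leavitt path algebra `L_K(G)`. -/
noncomputable def LeavittPathAlgebra (K : Type*) [Field K] {V E : Type*} (G : DirGraph V E) : Type _ :=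
  (LPA.con K G).Quotient

namespace LeavittPathAlgebra

noncomputable instance instNonUnitalRing (K : Type*) [Field K] {V E : Type*} (G : DirGraph V E) :
    NonUnitalRing (LeavittPathAlgebra K G) :=
  inferInstanceAs (NonUnitalRing (LPA.con K G).Quotient)

/-- The quotient map from the free algebra. -/
noncomputable def mk {K : Type*} [Field K] {V E : Type*} (G : DirGraph V E) (x : LPA.FreeAlg K V E) :
    LeavittPathAlgebra K G :=
  RingCon.toQuotient (c := LPA.con K G) x

theorem mk_surjective {K : Type*} [Field K] {V E : Type*} (G : DirGraph V E) :
    Function.Surjective (mk (K := K) G) :=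
  Quotient.mk''_surjective

noncomputable instance instModule (K : Type*) [Field K] {V E : Type*} (G : DirGraph V E) :
    Module K (LeavittPathAlgebra K G) where
  smul k := Quotient.map' (fun x => k • x) fun _ _ h => LPA.con_smul K G k h
  one_smul x := by
    obtain ⟨x, rfl⟩ := mk_surjective G x
    exact congrArg (mk G) (one_smul K x)
  mul_smul k l x := by
    obtain ⟨x, rfl⟩ := mk_surjective G x
    exact congrArg (mk G) (mul_smul k l x)
  smul_zero k := congrArg (mk G) (smul_zero k)
  smul_add k x y := by
    obtain ⟨x, rfl⟩ := mk_surjective G x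
    obtain ⟨y, rfl⟩ := mk_surjective G y
    exact congrArg (mk G) (smul_add k x y)
  add_smul k l x := by
    obtain ⟨x, rfl⟩ := mk_surjective G x
    exact congrArg (mk G) (add_smul k l x)
  zero_smul x := by
    obtain ⟨x, rfl⟩ := mk_surjective G x
    exact congrArg (mk G) (zero_smul K x)

instance instIsScalarTower (K : Type*) [Field K] {V E : Type*} (G : DirGraph V E) :
    IsScalarTower K (LeavittPathAlgebra K G) (LeavittPathAlgebra K G) where
  smul_assoc k x y := by
    obtain ⟨x, rfl⟩ := mk_surjective G x
    obtain ⟨y, rfl⟩ := mk_surjective G y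
    exact congrArg (mk G) (smul_mul_assoc k x y)

instance instSMulCommClass (K : Type*) [Field K] {V E : Type*} (G : DirGraph V E) :
    SMulCommClass K (LeavittPathAlgebra K G) (LeavittPathAlgebra K G) where
  smul_comm k x y := by
    obtain ⟨x, rfl⟩ := mk_surjective G x
    obtain ⟨y, rfl⟩ := mk_surjective G y
    exact congrArg (mk G) (mul_smul_comm k x y).symm

/-- The involution of `L_K(G)` induced by that of `K`: it sends `k` times a word in the
generators to `k*` times the reversed word, with `v* = v` and `e`, `e*` interchanged. -/
noncomputable instance instStarRing (K : Type*) [Field K] [StarRing K] {V E : Type*}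
    (G : DirGraph V E) : StarRing (LeavittPathAlgebra K G) where
  star := Quotient.map' (LPA.freeStar K V E) fun _ _ h => LPA.con_star K G h
  star_involutive x := by
    obtain ⟨x, rfl⟩ := mk_surjective G x
    exact congrArg (mk G) (LPA.freeStar_freeStar K x)
  star_mul x y := by
    obtain ⟨x, rfl⟩ := mk_surjective G x
    obtain ⟨y, rfl⟩ := mk_surjective G y
    exact congrArg (mk G) (LPA.freeStar_mul K x y)
  star_add x y := by
    obtain ⟨x, rfl⟩ := mk_surjective G x
    obtain ⟨y, rfl⟩ := mk_surjective G y
    exact congrArg (mk G) (map_add (LPA.freeStar K V E) x y)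

end LeavittPathAlgebra

/-! ### Traces and involutions -/

/-- A trace: an additive map with `t (x * y) = t (y * x)`. -/
structure IsTrace {R T : Type*} [NonUnitalRing R] [NonUnitalRing T] (t : R → T) : Prop where
  map_add : ∀ x y, t (x + y) = t x + t y
  map_mul_comm : ∀ x y, t (x * y) = t (y * x)

/-- `[R, R]`: the additive subgroup generated by the commutators. -/
def commutatorAddSubgroup (R : Type*) [NonUnitalRing R] : AddSubgroup R :=
  AddSubgroup.closure {z | ∃ x y : R, z = x * y - y * x}

/-- A trace is minimal if it vanishes only on `[R, R]`. -/
def IsMinimalTrace {R T : Type*} [NonUnitalRing R] [NonUnitalRing T] (t : R → T) : Prop :=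
  IsTrace t ∧ ∀ x, t x = 0 → x ∈ commutatorAddSubgroup R

/-- `x ≥ 0`: `x` is a sum of elements of the form `y y*`. -/
def IsPositiveElement {R : Type*} [NonUnitalRing R] [StarRing R] (x : R) : Prop :=
  x ∈ AddSubmonoid.closure (Set.range fun y : R => y * star y)

/-- A trace is faithful if `t x > 0` whenever `x > 0`. -/
def IsFaithfulTrace {R T : Type*} [NonUnitalRing R] [StarRing R] [NonUnitalRing T] [StarRing T]
    (t : R → T) : Prop :=
  IsTrace t ∧ ∀ x, IsPositiveElement x → x ≠ 0 → IsPositiveElement (t x) ∧ t x ≠ 0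

/-- The map `t` commutes with scalars from `C`. -/
def IsScalarLinear (C : Type*) {R T : Type*} [SMul C R] [SMul C T] (t : R → T) : Prop :=
  ∀ (c : C) (x : R), t (c • x) = c • t x

/-- The involution of `R` is positive definite. -/
def IsPosDefInvolution (R : Type*) [NonUnitalRing R] [StarRing R] : Prop :=
  ∀ (n : ℕ) (x : Fin n → R), ∑ i, x i * star (x i) = 0 → ∀ i, x i = 0

/-! (6) → (1). In a no-exit graph as in the theorem, no infinite path meets branched vertices only
(`wellFounded_branchedStep`), so one can induct along the edges that leave branched vertices. This
has two uses. First, the elements `p q*`, with paths `p` and `q` ending at a common unbranched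
vertex, span the algebra (`span_unbranchedMonomials`). Second, let `δ v` count the paths from `v` to
the first unbranched vertex. With `δ v` points over each `v`, the algebra acts on the free
`K[T;T⁻¹]`-module on all points: an edge moves points along itself and multiplies by `T`. The
constant coefficient of the operator trace is a `K`-linear trace `t`. The variable `T` makes `t`
vanish on closed paths of positive length, while an unbranched vertex has trace 1. Hence the nonzero
`p q*` are orthonormal for `t (a * star b)` (`trace_mul_star_self`, `trace_mul_star_of_ne`), so `t
(y * star y)` is a sum of terms `c * star c` over the coefficients of `y`, and positive definiteness
of `K` makes `t` faithful.

(1) → (3). Pair `t` with the universal trace into `A / [A, A]`, inside the square-zero extension `K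
⊕ A / [A, A]`. The second component gives minimality. Faithfulness survives because there a
self-adjoint element with positive nonzero scalar part is positive (`isPositiveElement_of_fst`).

(5) → (6). For a closed path `π` at `v`, `v - π π*` is a projection of trace `t v - t (π* π) = 0`.
If the cycle has an exit, this projection is nonzero, which contradicts faithfulness. That uses that
vertices are nonzero, which follows from a branching system with infinite fibres. The other
implications forget structure. -/

open LaurentPolynomial

namespace LeavittPathAlgebra

/-! ### Relations and the universal property of the Leavitt path algebra -/

section Basic

variable {K : Type u} [Field K] {V : Type v} {E : Type w} (G : DirGraph V E)

/-- The quotient map from the free algebra as a homomorphism of `K`-algebras. -/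
noncomputable def mkHom : LPA.FreeAlg K V E →ₙₐ[K] LeavittPathAlgebra K G where
  toFun := mk G
  map_smul' _ _ := rfl
  map_zero' := rfl
  map_add' _ _ := rfl
  map_mul' _ _ := rfl

/-- The image of a generating symbol in the Leavitt path algebra. -/
noncomputable def ofGen (x : LPA.Gen V E) : LeavittPathAlgebra K G :=
  mkHom G (LPA.gen K x)

/-- A vertex as an element of the Leavitt path algebra. -/
noncomputable abbrev vertex (v : V) : LeavittPathAlgebra K G := ofGen G (.vertex v)

/-- An edge as an element of the Leavitt path algebra. -/
noncomputable abbrev edge (e : E) : LeavittPathAlgebra K G := ofGen G (.edge e)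

/-- A ghost edge as an element of the Leavitt path algebra. -/
noncomputable abbrev ghost (e : E) : LeavittPathAlgebra K G := ofGen G (.ghost e)

variable {G}

theorem mkHom_eq_of_defRel {a b : LPA.FreeAlg K V E} (h : LPA.DefRel K G a b) :
    mkHom G a = mkHom G b :=
  (RingCon.eq (LPA.con K G)).2
    (RingConGen.Rel.of _ _ ⟨1, a, b, h, (one_smul K a).symm, (one_smul K b).symm⟩)

theorem vertex_mul_self (v : V) : vertex G v * vertex G v = vertex (K := K) G v := by
  simpa [ofGen] using mkHom_eq_of_defRel (.v_same v : LPA.DefRel K G _ _)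

theorem vertex_mul_of_ne {v v' : V} (h : v ≠ v') :
    vertex G v * vertex G v' = (0 : LeavittPathAlgebra K G) := by
  simpa [ofGen] using mkHom_eq_of_defRel (.v_diff v v' h : LPA.DefRel K G _ _)

theorem source_mul_edge (e : E) : vertex G (G.source e) * edge G e = edge (K := K) G e := by
  simpa [ofGen] using mkHom_eq_of_defRel (.e1_source e : LPA.DefRel K G _ _)

theorem edge_mul_range (e : E) : edge G e * vertex G (G.range e) = edge (K := K) G e := by
  simpa [ofGen] using mkHom_eq_of_defRel (.e1_range e : LPA.DefRel K G _ _)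

theorem range_mul_ghost (e : E) : vertex G (G.range e) * ghost G e = ghost (K := K) G e := by
  simpa [ofGen] using mkHom_eq_of_defRel (.e2_range e : LPA.DefRel K G _ _)

theorem ghost_mul_source (e : E) : ghost G e * vertex G (G.source e) = ghost (K := K) G e := by
  simpa [ofGen] using mkHom_eq_of_defRel (.e2_source e : LPA.DefRel K G _ _)

theorem ghost_mul_edge (e : E) :
    ghost G e * edge G e = vertex (K := K) G (G.range e) := by
  simpa [ofGen] using mkHom_eq_of_defRel (.ck1_same e : LPA.DefRel K G _ _)

theorem ghost_mul_edge_of_ne {e f : E} (h : e ≠ f) :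
    ghost G e * edge G f = (0 : LeavittPathAlgebra K G) := by
  simpa [ofGen] using mkHom_eq_of_defRel (.ck1_diff e f h : LPA.DefRel K G _ _)

theorem vertex_eq_sum {v : V} (h : G.IsRegular v) :
    vertex (K := K) G v = ∑ e ∈ h.1.toFinset, edge G e * ghost G e := by
  simpa [ofGen] using mkHom_eq_of_defRel (.ck2 v h : LPA.DefRel K G _ _)

/-- A `K`-subspace that contains the generators and is stable under left multiplication by them
is the whole algebra. -/
theorem eq_top_of_ofGen_mul_mem (W : Submodule K (LeavittPathAlgebra K G))
    (h₁ : ∀ g, ofGen G g ∈ W) (h₂ : ∀ g, ∀ x ∈ W, ofGen G g * x ∈ W) : W = ⊤ := by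
  refine eq_top_iff.2 ?_
  rintro x -
  obtain ⟨x, rfl⟩ := mk_surjective G x
  change mkHom G x ∈ W
  have hw : ∀ a : FreeSemigroup (LPA.Gen V E), mkHom G (MonoidAlgebra.single a (1 : K)) ∈ W := by
    intro a
    induction a using FreeSemigroup.recOnMul with
    | ih1 g => exact h₁ g
    | ih2 g a _ ha =>
      have : (MonoidAlgebra.single (FreeSemigroup.of g * a) (1 : K)) =
          LPA.gen K g * MonoidAlgebra.single a 1 := by
        simp [LPA.gen, MonoidAlgebra.single_mul_single]
      rw [this, map_mul]
      exact h₂ g _ ha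
  induction x using MonoidAlgebra.induction_linear with
  | zero => rw [map_zero]; exact W.zero_mem
  | add f g hf hg => rw [map_add]; exact W.add_mem hf hg
  | single a k =>
    have : MonoidAlgebra.single a k = k • MonoidAlgebra.single a (1 : K) := by simp
    rw [this, map_smul]
    exact W.smul_mem _ (hw a)

section Lift

variable {B : Type*} [NonUnitalRing B] [Module K B] [IsScalarTower K B B] [SMulCommClass K B B]

/-- The homomorphism from the free algebra given by the images of the generating symbols. -/
noncomputable def freeLift (f : LPA.Gen V E → B) : LPA.FreeAlg K V E →ₙₐ[K] B :=
  MonoidAlgebra.liftMagma K (FreeSemigroup.lift f)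

theorem freeLift_gen (f : LPA.Gen V E → B) (x : LPA.Gen V E) :
    freeLift f (LPA.gen K x) = f x := by
  simp [freeLift, LPA.gen]

theorem freeLift_eq_of_con (f : LPA.Gen V E → B)
    (h : ∀ a b, LPA.DefRel K G a b → freeLift f a = freeLift f b) {x y : LPA.FreeAlg K V E}
    (hxy : LPA.con K G x y) : freeLift f x = freeLift f y := by
  change RingConGen.Rel _ x y at hxy
  induction hxy with
  | of x y hxy =>
    obtain ⟨k, a, b, hab, rfl, rfl⟩ := hxy
    rw [map_smul, map_smul, h a b hab]
  | refl x => rfl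
  | symm _ ih => exact ih.symm
  | trans _ _ ih₁ ih₂ => exact ih₁.trans ih₂
  | add _ _ ih₁ ih₂ => rw [map_add, map_add, ih₁, ih₂]
  | mul _ _ ih₁ ih₂ => rw [map_mul, map_mul, ih₁, ih₂]

/-- The homomorphism from the Leavitt path algebra given by images of the generating symbols that
satisfy the defining relations. -/
noncomputable def lift (f : LPA.Gen V E → B)
    (h : ∀ a b, LPA.DefRel K G a b → freeLift f a = freeLift f b) :
    LeavittPathAlgebra K G →ₙₐ[K] B where
  toFun x := Quotient.liftOn' x (freeLift f) fun _ _ hxy => freeLift_eq_of_con f h hxy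
  map_smul' k x := by
    obtain ⟨x, rfl⟩ := mk_surjective G x
    exact map_smul (freeLift f) k x
  map_zero' := map_zero (freeLift f)
  map_add' x y := by
    obtain ⟨x, rfl⟩ := mk_surjective G x
    obtain ⟨y, rfl⟩ := mk_surjective G y
    exact map_add (freeLift f) x y
  map_mul' x y := by
    obtain ⟨x, rfl⟩ := mk_surjective G x
    obtain ⟨y, rfl⟩ := mk_surjective G y
    exact map_mul (freeLift f) x y

theorem lift_ofGen (f : LPA.Gen V E → B)
    (h : ∀ a b, LPA.DefRel K G a b → freeLift f a = freeLift f b) (x : LPA.Gen V E) :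
    lift f h (ofGen G x) = f x :=
  freeLift_gen f x

end Lift

section Star

variable [StarRing K]

theorem star_ofGen (x : LPA.Gen V E) :
    star (ofGen (K := K) G x) = ofGen G x.conj :=
  congrArg (mkHom G) (LPA.freeStar_gen K x)

theorem star_vertex (v : V) : star (vertex (K := K) G v) = vertex G v := star_ofGen _

theorem star_edge (e : E) : star (edge (K := K) G e) = ghost G e := star_ofGen _

theorem star_smul' (k : K) (x : LeavittPathAlgebra K G) : star (k • x) = star k • star x := by
  obtain ⟨x, rfl⟩ := mk_surjective G x
  exact congrArg (mk G) (LPA.freeStar_smul K k x)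

instance instStarModule : StarModule K (LeavittPathAlgebra K G) := ⟨star_smul'⟩

end Star

end Basic

end LeavittPathAlgebra

/-! ### Branching systems and their representations -/

/-- A branching system of a graph: a set `X` fibred over the vertices, and for each edge `e` an
injection of the fibre over `r(e)` into the fibre over `s(e)`, so that the images of the edges
leaving a regular vertex partition its fibre. -/
structure BranchingSystem {V : Type*} {E : Type*} (G : DirGraph V E) (X : Type*) where
  /-- the vertex under a point -/
  base : X → V
  /-- the action of an edge `e`, meaningful on the points over `r(e)` -/
  act : E → X → X
  base_act : ∀ e x, base x = G.range e → base (act e x) = G.source e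
  act_inj : ∀ e x f y, base x = G.range e → base y = G.range f → act e x = act f y → e = f ∧ x = y
  exists_act : ∀ x, G.IsRegular (base x) →
    ∃ e y, G.source e = base x ∧ base y = G.range e ∧ act e y = x

namespace BranchingSystem

variable {V : Type v} {E : Type w} {G : DirGraph V E} {X : Type*}

/-- The branching system with given fibres, where the fibre over a source is identified with the
disjoint union of the fibres over the ranges of the edges that leave it. -/
noncomputable def ofFibers (F : V → Type*)
    (Θ : ∀ v, {e : E | G.source e = v}.Nonempty →
      (Σ e : {e : E // G.source e = v}, F (G.range e.1)) ≃ F v) :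
    BranchingSystem G (Σ v, F v) where
  base := Sigma.fst
  -- Away from the fibre over `r(e)` the value `x` is a dummy; no axiom looks at it.
  act e x := open Classical in
    if h : x.1 = G.range e then ⟨G.source e, Θ _ ⟨e, rfl⟩ ⟨⟨e, rfl⟩, h ▸ x.2⟩⟩ else x
  base_act e x h := by simp [h]
  act_inj := by
    -- With the two vertices as variables, their equality can be substituted before the bijection `Θ
    -- v` is cancelled.
    have key : ∀ v v' (a : Σ e : {e : E // G.source e = v}, F (G.range e.1))
        (a' : Σ e : {e : E // G.source e = v'}, F (G.range e.1)) h h',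
        (⟨v, Θ v h a⟩ : Σ v, F v) = ⟨v', Θ v' h' a'⟩ →
          (⟨a.1.1, a.2⟩ : Σ e : E, F (G.range e)) = ⟨a'.1.1, a'.2⟩ := by
      intro v v' a a' h h' heq
      obtain rfl : v = v' := congrArg Sigma.fst heq
      simp only [Sigma.mk.injEq, heq_eq_eq, true_and, EmbeddingLike.apply_eq_iff_eq] at heq
      rw [heq]
    rintro e ⟨v, x⟩ f ⟨v', y⟩ (rfl : v = _) (rfl : v' = _) h
    simp only [dite_true] at h
    have := key _ _ _ _ _ _ h
    simp only [Sigma.mk.injEq] at this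
    obtain ⟨rfl, h2⟩ := this
    exact ⟨rfl, by rw [eq_of_heq h2]⟩
  exists_act := by
    rintro ⟨v, x⟩ h
    obtain ⟨⟨⟨e, he⟩, y⟩, hy⟩ := (Θ v h.2).surjective x
    subst he
    exact ⟨e, ⟨G.range e, y⟩, rfl, rfl, by simp [hy]⟩

variable {K : Type u} [Field K] (S : BranchingSystem G X)

/-- The endomorphisms of the free module over the Laurent polynomials on the points of a
branching system. -/
abbrev Op (K : Type*) [Field K] (X : Type*) : Type _ := Module.End K[T;T⁻¹] (X →₀ K[T;T⁻¹])

open Classical in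
/-- The image of a basis vector under a generator: `e` moves a point along the edge and
multiplies by the variable, `e*` does the converse, and a vertex projects onto its fibre. -/
noncomputable def genVec : LPA.Gen V E → X → (X →₀ K[T;T⁻¹])
  | .vertex v, x => if S.base x = v then Finsupp.single x 1 else 0
  | .edge e, x => if S.base x = G.range e then Finsupp.single (S.act e x) (T 1) else 0
  | .ghost e, x => if h : ∃ y, S.base y = G.range e ∧ S.act e y = x then
      Finsupp.single h.choose (T (-1)) else 0

variable (K) in
/-- The operator of a generator. -/
noncomputable def genOp (g : LPA.Gen V E) : Op K X :=
  Finsupp.linearCombination K[T;T⁻¹] (S.genVec g)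

theorem genOp_single (g : LPA.Gen V E) (x : X) (a : K[T;T⁻¹]) :
    S.genOp K g (Finsupp.single x a) = a • S.genVec g x := by
  simp [genOp]

theorem genVec_vertex_of_eq {v : V} {x : X} (h : S.base x = v) :
    S.genVec (K := K) (.vertex v) x = Finsupp.single x 1 := by simp [genVec, h]

theorem genVec_vertex_of_ne {v : V} {x : X} (h : S.base x ≠ v) :
    S.genVec (K := K) (.vertex v) x = 0 := by simp [genVec, h]

theorem genVec_edge_of_eq {e : E} {x : X} (h : S.base x = G.range e) :
    S.genVec (K := K) (.edge e) x = Finsupp.single (S.act e x) (T 1) := by simp [genVec, h]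

theorem genVec_edge_of_ne {e : E} {x : X} (h : S.base x ≠ G.range e) :
    S.genVec (K := K) (.edge e) x = 0 := by simp [genVec, h]

/-- The preimage chosen in `genVec` is forced to be `x` by `act_inj`. -/
theorem genVec_ghost_act {e : E} {x : X} (h : S.base x = G.range e) :
    S.genVec (K := K) (.ghost e) (S.act e x) = Finsupp.single x (T (-1)) := by
  have h' : ∃ y, S.base y = G.range e ∧ S.act e y = S.act e x := ⟨x, h, rfl⟩
  rw [genVec, dif_pos h', (S.act_inj e _ e _ h'.choose_spec.1 h h'.choose_spec.2).2]

theorem genVec_ghost_of_not {e : E} {x : X} (h : ∀ y, S.base y = G.range e → S.act e y ≠ x) :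
    S.genVec (K := K) (.ghost e) x = 0 := by
  rw [genVec, dif_neg]
  rintro ⟨y, h1, h2⟩
  exact h y h1 h2

theorem op_ext {a b : Op K X} (h : ∀ x, a (Finsupp.single x 1) = b (Finsupp.single x 1)) :
    a = b :=
  Finsupp.lhom_ext' fun x => LinearMap.ext_ring (h x)

/-- Everything is checked on basis vectors. The powers of `T` cancel in `e* e` and `e e*`; `act_inj`
yields the relations for `e* f`, and `exists_act` the one at regular vertices. -/
theorem genOp_defRel (a b : LPA.FreeAlg K V E) (h : LPA.DefRel K G a b) :
    LeavittPathAlgebra.freeLift (S.genOp K) a = LeavittPathAlgebra.freeLift (S.genOp K) b := by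
  induction h with
  | v_same v =>
    simp only [map_mul, LeavittPathAlgebra.freeLift_gen]
    refine op_ext fun x => ?_
    by_cases hx : S.base x = v <;>
      simp [genOp_single, genVec_vertex_of_eq, genVec_vertex_of_ne, hx]
  | v_diff v v' hne =>
    simp only [map_mul, LeavittPathAlgebra.freeLift_gen, map_zero]
    refine op_ext fun x => ?_
    by_cases hx : S.base x = v'
    · simp [genOp_single, genVec_vertex_of_eq, genVec_vertex_of_ne, hx, hne.symm]
    · simp [genOp_single, genVec_vertex_of_ne, hx]
  | e1_source e =>
    simp only [map_mul, LeavittPathAlgebra.freeLift_gen]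
    refine op_ext fun x => ?_
    by_cases hx : S.base x = G.range e
    · simp [genOp_single, genVec_edge_of_eq, genVec_vertex_of_eq, hx, S.base_act]
    · simp [genOp_single, genVec_edge_of_ne, hx]
  | e1_range e =>
    simp only [map_mul, LeavittPathAlgebra.freeLift_gen]
    refine op_ext fun x => ?_
    by_cases hx : S.base x = G.range e
    · simp [genOp_single, genVec_edge_of_eq, genVec_vertex_of_eq, hx]
    · simp [genOp_single, genVec_edge_of_ne, genVec_vertex_of_ne, hx]
  | e2_range e =>
    simp only [map_mul, LeavittPathAlgebra.freeLift_gen]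
    refine op_ext fun x => ?_
    by_cases hx : ∃ y, S.base y = G.range e ∧ S.act e y = x
    · obtain ⟨y, hy, rfl⟩ := hx
      simp [genOp_single, genVec_ghost_act, genVec_vertex_of_eq, hy]
    · simp only [not_exists, not_and] at hx
      simp [genOp_single, S.genVec_ghost_of_not hx]
  | e2_source e =>
    simp only [map_mul, LeavittPathAlgebra.freeLift_gen]
    refine op_ext fun x => ?_
    by_cases hx : ∃ y, S.base y = G.range e ∧ S.act e y = x
    · obtain ⟨y, hy, rfl⟩ := hx
      simp [genOp_single, genVec_ghost_act, genVec_vertex_of_eq, hy, S.base_act]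
    · simp only [not_exists, not_and] at hx
      by_cases hx' : S.base x = G.source e
      · simp [genOp_single, S.genVec_ghost_of_not hx, genVec_vertex_of_eq, hx']
      · simp [genOp_single, S.genVec_ghost_of_not hx, genVec_vertex_of_ne, hx']
  | ck1_same e =>
    simp only [map_mul, LeavittPathAlgebra.freeLift_gen]
    refine op_ext fun x => ?_
    by_cases hx : S.base x = G.range e
    · rw [Module.End.mul_apply, genOp_single, genOp_single, genVec_edge_of_eq _ hx, one_smul,
        genOp_single, genVec_ghost_act _ hx, genVec_vertex_of_eq _ hx, Finsupp.smul_single,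
        smul_eq_mul, ← T_add, one_smul, add_neg_cancel, T_zero]
    · simp [genOp_single, genVec_edge_of_ne, genVec_vertex_of_ne, hx]
  | ck1_diff e f hne =>
    simp only [map_mul, LeavittPathAlgebra.freeLift_gen, map_zero]
    refine op_ext fun x => ?_
    by_cases hx : S.base x = G.range f
    · have : ∀ y, S.base y = G.range e → S.act e y ≠ S.act f x := fun y hy h =>
        hne (S.act_inj e y f x hy hx h).1
      simp [genOp_single, genVec_edge_of_eq, hx, S.genVec_ghost_of_not this]
    · simp [genOp_single, genVec_edge_of_ne, hx]
  | ck2 v h =>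
    simp only [map_sum, map_mul, LeavittPathAlgebra.freeLift_gen]
    refine op_ext fun x => ?_
    rw [LinearMap.sum_apply]
    by_cases hx : S.base x = v
    -- The point lies in the image of exactly one edge `e`, and only the summand of `e` survives.
    · obtain ⟨e, y, h1, h2, rfl⟩ := S.exists_act x (hx ▸ h)
      rw [Finset.sum_eq_single e]
      · rw [Module.End.mul_apply, genOp_single, genOp_single, genVec_ghost_act _ h2, one_smul,
          one_smul, genOp_single, genVec_edge_of_eq _ h2, genVec_vertex_of_eq _ hx,
          Finsupp.smul_single, smul_eq_mul, ← T_add, neg_add_cancel, T_zero]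
      · intro f _ hf
        have : ∀ z, S.base z = G.range f → S.act f z ≠ S.act e y := fun z hz h =>
          hf (S.act_inj f z e y hz h2 h).1
        simp [genOp_single, S.genVec_ghost_of_not this]
      · intro he
        simp [h1, hx] at he
    · rw [genOp_single, genVec_vertex_of_ne _ hx, smul_zero]
      refine (Finset.sum_eq_zero fun e he => ?_).symm
      have : ∀ z, S.base z = G.range e → S.act e z ≠ x := by
        rintro z hz rfl
        rw [Set.Finite.mem_toFinset] at he
        exact hx ((S.base_act e z hz).trans he)
      simp [genOp_single, S.genVec_ghost_of_not this]

variable (K) in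
/-- The representation of the Leavitt path algebra that belongs to a branching system. -/
noncomputable def rep : LeavittPathAlgebra K G →ₙₐ[K] Op K X :=
  LeavittPathAlgebra.lift (S.genOp K) S.genOp_defRel

theorem rep_ofGen_single (g : LPA.Gen V E) (x : X) (a : K[T;T⁻¹]) :
    S.rep K (LeavittPathAlgebra.ofGen G g) (Finsupp.single x a) = a • S.genVec g x := by
  rw [rep, LeavittPathAlgebra.lift_ofGen, genOp_single]

theorem vertex_ne_zero (x : X) :
    (LeavittPathAlgebra.vertex G (S.base x) : LeavittPathAlgebra K G) ≠ 0 := by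
  intro h
  have := S.rep_ofGen_single (K := K) (.vertex (S.base x)) x 1
  rw [show LeavittPathAlgebra.ofGen G (.vertex (S.base x)) = 0 from h, map_zero,
    genVec_vertex_of_eq _ rfl, one_smul] at this
  exact one_ne_zero (Finsupp.single_eq_zero.1 this.symm)

end BranchingSystem

namespace LeavittPathAlgebra

/-- The vertices of a row-finite graph are nonzero in its Leavitt path algebra. -/
theorem vertex_ne_zero (K : Type u) [Field K] {V : Type v} {E : Type w} {G : DirGraph V E}
    (hrow : G.RowFinite) (v : V) : (vertex G v : LeavittPathAlgebra K G) ≠ 0 := by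
  -- A nonempty finite disjoint union of copies of `ℕ` is again countably infinite, so all fibres
  -- can be taken to be `ℕ`, whatever the graph.
  have Θ : ∀ v, {e : E | G.source e = v}.Nonempty →
      Nonempty ((Σ _ : {e : E // G.source e = v}, ℕ) ≃ ℕ) := fun v hv => by
    have : Finite {e : E // G.source e = v} := hrow v
    have : Nonempty {e : E // G.source e = v} := hv.to_subtype
    exact nonempty_equiv_of_countable
  exact (BranchingSystem.ofFibers (fun _ => ℕ) fun v hv => (Θ v hv).some).vertex_ne_zero ⟨v, 0⟩

end LeavittPathAlgebra

/-! ### The trace of finitely supported operators -/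

namespace BranchingSystem

section Operators

variable {K : Type u} [Field K] {X : Type*}

/-- Only finitely many basis vectors are not killed. -/
def FinitelySupported (a : Op K X) : Prop := {x | a (Finsupp.single x 1) ≠ 0}.Finite

/-- The trace of a finitely supported operator. -/
noncomputable def opTrace (a : Op K X) : K[T;T⁻¹] := ∑ᶠ x, a (Finsupp.single x 1) x

theorem FinitelySupported.diag_finite {a : Op K X} (ha : FinitelySupported a) :
    (Function.support fun x => a (Finsupp.single x 1) x).Finite :=
  ha.subset fun x hx h => hx (by simp [h])

theorem opTrace_add {a b : Op K X} (ha : FinitelySupported a) (hb : FinitelySupported b) :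
    opTrace (a + b) = opTrace a + opTrace b := by
  rw [opTrace, opTrace, opTrace, ← finsum_add_distrib ha.diag_finite hb.diag_finite]
  rfl

theorem opTrace_smul (k : K) (a : Op K X) (ha : FinitelySupported a) :
    opTrace (k • a) = k • opTrace a := by
  rw [opTrace, opTrace, smul_finsum' k ha.diag_finite]
  rfl

theorem FinitelySupported.apply_eq_sum {a : Op K X} {s : Finset X}
    (hs : ∀ x ∉ s, a (Finsupp.single x 1) = 0) (f : X →₀ K[T;T⁻¹]) :
    a f = ∑ x ∈ s, f x • a (Finsupp.single x 1) := by
  classical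
  have : a = ∑ x ∈ s, (Finsupp.lapply x).smulRight (a (Finsupp.single x 1)) := by
    refine op_ext fun y => ?_
    simp only [LinearMap.sum_apply, LinearMap.smulRight_apply, Finsupp.lapply_apply,
      Finsupp.single_apply, ite_smul, one_smul, zero_smul, Finset.sum_ite_eq]
    split_ifs with hy
    · rfl
    · exact hs y hy
  conv_lhs => rw [this]
  simp [LinearMap.sum_apply]

theorem opTrace_mul_comm {a b : Op K X} (ha : FinitelySupported a) (hb : FinitelySupported b) :
    opTrace (a * b) = opTrace (b * a) := by
  classical
  set s : Finset X := ha.toFinset ∪ hb.toFinset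
  have hsa : ∀ x ∉ s, a (Finsupp.single x 1) = 0 := fun x hx => by
    by_contra h
    exact hx (Finset.mem_union_left _ (ha.mem_toFinset.2 h))
  have hsb : ∀ x ∉ s, b (Finsupp.single x 1) = 0 := fun x hx => by
    by_contra h
    exact hx (Finset.mem_union_right _ (hb.mem_toFinset.2 h))
  -- Rows may leave `s`, but columns outside `s` vanish, so the trace of a product only sees entries
  -- with both indices in `s`.
  have key : ∀ c d : Op K X, (∀ x ∉ s, c (Finsupp.single x 1) = 0) →
      (∀ x ∉ s, d (Finsupp.single x 1) = 0) → opTrace (c * d) =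
        ∑ x ∈ s, ∑ y ∈ s, d (Finsupp.single x 1) y * c (Finsupp.single y 1) x := by
    intro c d hc hd
    rw [opTrace, finsum_eq_sum_of_support_subset (s := s)]
    · refine Finset.sum_congr rfl fun x _ => ?_
      rw [Module.End.mul_apply, FinitelySupported.apply_eq_sum hc, Finsupp.finsetSum_apply]
      rfl
    · intro x hx
      by_contra hxs
      exact hx (by simp [Module.End.mul_apply, hd x hxs])
  rw [key a b hsa hsb, key b a hsb hsa, Finset.sum_comm]
  exact Finset.sum_congr rfl fun x _ => Finset.sum_congr rfl fun y _ => mul_comm _ _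

/-- Every basis vector is mapped to zero or to `Tⁿ` times a basis vector. -/
def IsMonomial (n : ℤ) (a : Op K X) : Prop :=
  ∀ x, a (Finsupp.single x 1) = 0 ∨ ∃ y, a (Finsupp.single x 1) = Finsupp.single y (T n)

theorem IsMonomial.mul {m n : ℤ} {a b : Op K X} (ha : IsMonomial m a) (hb : IsMonomial n b) :
    IsMonomial (m + n) (a * b) := by
  intro x
  rw [Module.End.mul_apply]
  obtain h | ⟨y, h⟩ := hb x
  · exact .inl (by rw [h, map_zero])
  · have : Finsupp.single y (T n : K[T;T⁻¹]) = (T n : K[T;T⁻¹]) • Finsupp.single y 1 := by simp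
    rw [h, this, map_smul]
    obtain h' | ⟨z, h'⟩ := ha y
    · exact .inl (by rw [h', smul_zero])
    · exact .inr ⟨z, by rw [h', Finsupp.smul_single, smul_eq_mul, ← T_add, add_comm]⟩

/-- Diagonal entries are `0` or `T n`. This is the purpose of the variable: a cycle through
unbranched vertices fixes the point of a one-point fibre, and without `T` it would have trace 1. -/
theorem IsMonomial.coeff_opTrace {n : ℤ} {a : Op K X} (ha : IsMonomial n a) (hn : n ≠ 0)
    (hfin : FinitelySupported a) : (opTrace a).coeff 0 = 0 := by
  classical
  rw [opTrace, finsum_eq_sum _ hfin.diag_finite, AddMonoidAlgebra.coeff_sum,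
    Finsupp.finsetSum_apply]
  refine Finset.sum_eq_zero fun x _ => ?_
  obtain h | ⟨y, h⟩ := ha x
  · simp [h]
  · rw [h, Finsupp.single_apply]
    split_ifs
    · rw [T_apply, if_neg hn]
    · rfl

end Operators

/-! ### The trace of a branching system with finite fibres -/

section Trace

variable {K : Type u} [Field K] {V : Type v} {E : Type w} {G : DirGraph V E} {X : Type*}
  (S : BranchingSystem G X)

open LeavittPathAlgebra

theorem rep_ofGen_single_one (g : LPA.Gen V E) (x : X) :
    S.rep K (ofGen G g) (Finsupp.single x 1) = S.genVec g x := by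
  rw [rep_ofGen_single, one_smul]

theorem isMonomial_vertex (v : V) : IsMonomial 0 (S.rep K (vertex G v)) := fun x => by
  rw [rep_ofGen_single_one, T_zero]
  by_cases h : S.base x = v
  · exact .inr ⟨x, S.genVec_vertex_of_eq h⟩
  · exact .inl (S.genVec_vertex_of_ne h)

theorem isMonomial_edge (e : E) : IsMonomial 1 (S.rep K (edge G e)) := fun x => by
  rw [rep_ofGen_single_one]
  by_cases h : S.base x = G.range e
  · exact .inr ⟨_, S.genVec_edge_of_eq h⟩
  · exact .inl (S.genVec_edge_of_ne h)

theorem isMonomial_ghost (e : E) : IsMonomial (-1) (S.rep K (ghost G e)) := fun x => by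
  rw [rep_ofGen_single_one]
  by_cases h : ∃ y, S.base y = G.range e ∧ S.act e y = x
  · obtain ⟨y, hy, rfl⟩ := h
    exact .inr ⟨_, S.genVec_ghost_act hy⟩
  · simp only [not_exists, not_and] at h
    exact .inl (S.genVec_ghost_of_not h)

/-- A generator kills all basis vectors outside one finite fibre, and multiplication from the left
cannot revive a killed vector. -/
theorem finitelySupported_rep (hfin : ∀ v, {x | S.base x = v}.Finite)
    (a : LeavittPathAlgebra K G) :
    FinitelySupported (S.rep K a) := by
  let W : Submodule K (LeavittPathAlgebra K G) :=
    { carrier := {a | FinitelySupported (S.rep K a)}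
      zero_mem' := by simp [FinitelySupported]
      add_mem' := fun {a b} ha hb => (ha.union hb).subset fun x hx => by
        by_contra h
        simp only [Set.mem_union, Set.mem_ofPred_eq, not_or, not_not] at h
        exact hx (by rw [map_add, LinearMap.add_apply, h.1, h.2, add_zero])
      smul_mem' := fun k a ha => ha.subset fun x hx h => hx (by
        rw [map_smul, LinearMap.smul_apply, h, smul_zero]) }
  have hW : W = ⊤ := by
    refine eq_top_of_ofGen_mul_mem W (fun g => ?_) (fun g a ha => ha.subset fun x hx h => hx (by
      rw [map_mul, Module.End.mul_apply, h, map_zero]))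
    change Set.Finite _
    simp only [rep_ofGen_single_one]
    cases g with
    | vertex v =>
      refine (hfin v).subset fun x hx => ?_
      by_contra h
      exact hx (S.genVec_vertex_of_ne h)
    | edge e =>
      refine (hfin (G.range e)).subset fun x hx => ?_
      by_contra h
      exact hx (S.genVec_edge_of_ne h)
    | ghost e =>
      refine (hfin (G.source e)).subset fun x hx => ?_
      by_contra h
      exact hx (S.genVec_ghost_of_not fun y hy hxy => h (hxy ▸ S.base_act e y hy))
  have : a ∈ W := hW ▸ Submodule.mem_top
  exact this

variable (hfin : ∀ v, {x | S.base x = v}.Finite)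

/-- The trace of the Leavitt path algebra that belongs to a branching system with finite fibres:
the constant coefficient of the operator trace. -/
noncomputable def trace : LeavittPathAlgebra K G →ₗ[K] K where
  toFun a := (opTrace (S.rep K a)).coeff 0
  map_add' a b := by
    rw [map_add, opTrace_add (S.finitelySupported_rep hfin a) (S.finitelySupported_rep hfin b)]
    rfl
  map_smul' k a := by
    rw [map_smul, opTrace_smul _ _ (S.finitelySupported_rep hfin a)]
    rfl

theorem trace_mul_comm (a b : LeavittPathAlgebra K G) :
    S.trace hfin (a * b) = S.trace hfin (b * a) := by
  change (opTrace _).coeff 0 = (opTrace _).coeff 0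
  rw [map_mul, map_mul,
    opTrace_mul_comm (S.finitelySupported_rep hfin a) (S.finitelySupported_rep hfin b)]

theorem trace_of_isMonomial {n : ℤ} (hn : n ≠ 0) {a : LeavittPathAlgebra K G}
    (ha : IsMonomial n (S.rep K a)) : S.trace hfin a = 0 :=
  ha.coeff_opTrace hn (S.finitelySupported_rep hfin a)

theorem trace_vertex {x : X} (hx : ∀ y, S.base y = S.base x → y = x) :
    S.trace hfin (vertex (K := K) G (S.base x)) = 1 := by
  change (opTrace _).coeff 0 = 1
  rw [opTrace, finsum_eq_single _ x]
  · simp [rep_ofGen_single_one, genVec_vertex_of_eq]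
  · intro y hy
    rw [rep_ofGen_single_one, genVec_vertex_of_ne _ fun h => hy (hx y h)]
    rfl

end Trace

end BranchingSystem

/-! ### Unbranched vertices and well-founded induction on the graph -/

namespace DirGraph

variable {V : Type v} {E : Type w} (G : DirGraph V E)

/-- There is an edge from `a` to `b`. -/
def Step (a b : V) : Prop := ∃ e, G.source e = a ∧ G.range e = b

/-- A vertex is unbranched if every vertex that can be reached from it emits at most one edge. -/
def Unbranched (v : V) : Prop :=
  ∀ u, Relation.ReflTransGen G.Step v u → ∀ e f, G.source e = u → G.source f = u → e = f

variable {G}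

theorem Unbranched.eq_of_source {v : V} (h : G.Unbranched v) {e f : E} (he : G.source e = v)
    (hf : G.source f = v) : e = f :=
  h v .refl e f he hf

theorem Unbranched.range {e : E} (h : G.Unbranched (G.source e)) : G.Unbranched (G.range e) :=
  fun u hu => h u (.head ⟨e, rfl, rfl⟩ hu)

/-- A vertex without outgoing edges reaches only itself, so it is unbranched. -/
theorem exists_source_of_not_unbranched {v : V} (h : ¬ G.Unbranched v) :
    ∃ e, G.source e = v := by
  by_contra hv
  simp only [not_exists] at hv
  refine h fun u hu e f he hf => ?_
  obtain rfl | ⟨c, ⟨e', h1, _⟩, _⟩ := Relation.ReflTransGen.cases_head hu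
  · exact absurd he (hv e)
  · exact absurd h1 (hv e')

/-- The source of an infinite path without exits is unbranched. -/
theorem unbranched_of_isInfinitePath {f : ℕ → E} (hf : G.IsInfinitePath f)
    (hexit : ∀ i e, G.source e = G.source (f i) → e = f i) : G.Unbranched (G.source (f 0)) := by
  -- Without exits one cannot leave the path.
  have key : ∀ u, Relation.ReflTransGen G.Step (G.source (f 0)) u → ∃ i, u = G.source (f i) := by
    intro u hu
    induction hu with
    | refl => exact ⟨0, rfl⟩
    | tail _ h ih =>
      obtain ⟨i, rfl⟩ := ih
      obtain ⟨e, he, rfl⟩ := h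
      exact ⟨i + 1, by rw [hexit i e he, hf i]⟩
  intro u hu e e' he he'
  obtain ⟨i, rfl⟩ := key u hu
  rw [hexit i e he, hexit i e' he']

theorem EndsInSink.exists_unbranched {f : ℕ → E} (h : G.EndsInSink f) :
    ∃ n, G.Unbranched (G.source (f n)) := by
  obtain ⟨n, h1, _, h3⟩ := h
  exact ⟨n, unbranched_of_isInfinitePath h1 h3⟩

/-- The tail runs through edges of the cycle, so an exit of the tail would be an exit of the cycle.
-/
theorem EndsInCycle.exists_unbranched (hG : G.NoExit) {f : ℕ → E} (hf : G.IsInfinitePath f)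
    (h : G.EndsInCycle f) : ∃ n, G.Unbranched (G.source (f n)) := by
  obtain ⟨n, p, hp, h⟩ := h
  refine ⟨n, unbranched_of_isInfinitePath (f := fun i => f (n + i)) (fun i => hf (n + i)) ?_⟩
  intro i e he
  by_contra hne
  exact hG p hp e ⟨f (n + i), List.mem_of_getElem? (h i), he, hne⟩

variable (G) in
/-- `b` is the range of an edge with the branched source `a`. -/
def BranchedStep (b a : V) : Prop := ¬ G.Unbranched a ∧ G.Step a b

/-- A descending chain is an infinite path all of whose vertices are branched, but each infinite
path eventually meets an unbranched vertex. -/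
theorem wellFounded_branchedStep (hG : G.NoExit)
    (hinf : ∀ f : ℕ → E, G.IsInfinitePath f → G.EndsInSink f ∨ G.EndsInCycle f) :
    WellFounded G.BranchedStep := by
  rw [wellFounded_iff_isEmpty_descending_chain]
  refine ⟨fun ⟨a, ha⟩ => ?_⟩
  choose hT f hs hr using ha
  have hf : G.IsInfinitePath f := fun i => by rw [hr, hs]
  obtain ⟨n, hn⟩ := (hinf f hf).elim EndsInSink.exists_unbranched
    (EndsInCycle.exists_unbranched hG hf)
  exact hT n (hs n ▸ hn)

theorem RowFinite.isRegular (hrow : G.RowFinite) (e : E) : G.IsRegular (G.source e) :=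
  ⟨hrow _, e, rfl⟩

/-- There is a positive integral weight on the vertices that is `1` at unbranched vertices and
satisfies `δ(v) = ∑ δ(r(e))`, the sum over the edges leaving `v`, if there are any. -/
theorem exists_weight (hrow : G.RowFinite) (hwf : WellFounded G.BranchedStep) :
    ∃ δ : V → ℕ, (∀ v, G.Unbranched v → δ v = 1) ∧
      ∀ v, {e : E | G.source e = v}.Nonempty → δ v = ∑ e ∈ (hrow v).toFinset, δ (G.range e) := by
  classical
  let δ : V → ℕ := hwf.fix fun v rec =>
    if h : G.Unbranched v then 1
    else ∑ e ∈ (hrow v).toFinset.attach,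
      rec (G.range e.1) ⟨h, e.1, (hrow v).mem_toFinset.1 e.2, rfl⟩
  have hδ : ∀ v, δ v = if h : G.Unbranched v then 1
      else ∑ e ∈ (hrow v).toFinset, δ (G.range e) := by
    intro v
    rw [← Finset.sum_attach (hrow v).toFinset]
    exact hwf.fix_eq _ v
  have h1 : ∀ v, G.Unbranched v → δ v = 1 := fun v hv => by rw [hδ, dif_pos hv]
  refine ⟨δ, h1, fun v ⟨e, he⟩ => ?_⟩
  -- An unbranched `v` emits only `e`, and `r(e)` is unbranched too, so the sum is the single term
  -- 1.
  by_cases h : G.Unbranched v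
  · obtain rfl : G.source e = v := he
    rw [h1 _ h, Finset.sum_eq_single e, h1 _ h.range]
    · exact fun f hf hne => absurd (h.eq_of_source ((hrow _).mem_toFinset.1 hf) rfl) hne
    · exact fun hf => absurd ((hrow _).mem_toFinset.2 rfl) hf
  · rw [hδ, dif_neg h]

/-- There is a branching system with finite fibres that has a single point over each unbranched
vertex. -/
theorem exists_branchingSystem (hrow : G.RowFinite) (hwf : WellFounded G.BranchedStep) :
    ∃ (X : Type v) (S : BranchingSystem G X), (∀ v, {x | S.base x = v}.Finite) ∧
      ∀ v, G.Unbranched v → ∃ x, S.base x = v ∧ ∀ y, S.base y = v → y = x := by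
  classical
  obtain ⟨δ, h1, h2⟩ := exists_weight hrow hwf
  -- The recursion for the weight says exactly that the two sides have the same cardinality.
  have Θ : ∀ v, {e : E | G.source e = v}.Nonempty →
      Nonempty ((Σ e : {e : E // G.source e = v}, Fin (δ (G.range e.1))) ≃ Fin (δ v)) := by
    intro v hv
    have : Fintype {e : E // G.source e = v} := (hrow v).fintype
    refine ⟨Fintype.equivOfCardEq ?_⟩
    rw [Fintype.card_sigma, Fintype.card_fin, h2 v hv]
    simp only [Fintype.card_fin]
    exact (Finset.sum_subtype _ (fun e => by simp) fun e => δ (G.range e)).symm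
  refine ⟨_, BranchingSystem.ofFibers (fun v => Fin (δ v)) fun v hv => (Θ v hv).some, ?_, ?_⟩
  · intro v
    refine (Set.finite_range fun i : Fin (δ v) => (⟨v, i⟩ : Σ v, Fin (δ v))).subset ?_
    rintro ⟨_, i⟩ rfl
    exact ⟨i, rfl⟩
  · intro v hv
    refine ⟨⟨v, ⟨0, by rw [h1 v hv]; exact one_pos⟩⟩, rfl, ?_⟩
    rintro ⟨u, i⟩ (rfl : u = v)
    have : Subsingleton (Fin (δ u)) := by rw [h1 _ hv]; infer_instance
    exact congrArg (Sigma.mk u) (Subsingleton.elim _ _)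

end DirGraph

/-! ### Paths, and the elements `p q*` of the algebra -/

namespace DirGraph

variable {V : Type v} {E : Type w} (G : DirGraph V E)

/-- The source of a list of edges, regarded as a path that ends at `w`. -/
def pathSource (w : V) : List E → V
  | [] => w
  | e :: _ => G.source e

/-- The list of edges is a path that ends at `w`. -/
def IsPathTo (w : V) : List E → Prop
  | [] => True
  | e :: p => G.range e = G.pathSource w p ∧ IsPathTo w p

variable {G}

theorem pathSource_append (w : V) (p q : List E) :
    G.pathSource w (p ++ q) = G.pathSource (G.pathSource w q) p := by
  cases p <;> rfl

theorem isPathTo_append {w : V} {p q : List E} :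
    G.IsPathTo w (p ++ q) ↔ G.IsPathTo (G.pathSource w q) p ∧ G.IsPathTo w q := by
  induction p with
  | nil => simp [IsPathTo]
  | cons e p ih => simp [IsPathTo, ih, pathSource_append, and_assoc]

theorem isPathTo_of_isChain {p : List E} (hp : p.IsChain fun e f => G.range e = G.source f)
    (hne : p ≠ []) : G.IsPathTo (G.range (p.getLast hne)) p := by
  induction p with
  | nil => exact absurd rfl hne
  | cons e p ih =>
    cases p with
    | nil => exact ⟨rfl, trivial⟩
    | cons f p =>
      rw [List.isChain_cons_cons] at hp
      exact ⟨hp.1, ih hp.2 (by simp)⟩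

end DirGraph

namespace LeavittPathAlgebra

variable {K : Type u} [Field K] {V : Type v} {E : Type w} (G : DirGraph V E)

/-- The product in the Leavitt path algebra of a path that ends at `w`. -/
noncomputable def path (w : V) : List E → LeavittPathAlgebra K G
  | [] => vertex G w
  | e :: p => edge G e * path w p

variable {G}

theorem source_mul_path (w : V) (p : List E) :
    vertex G (G.pathSource w p) * path G w p = path (K := K) G w p := by
  cases p with
  | nil => exact vertex_mul_self w
  | cons e p => rw [path, ← mul_assoc, DirGraph.pathSource, source_mul_edge]

theorem vertex_mul_path_of_ne {u w : V} {p : List E} (h : u ≠ G.pathSource w p) :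
    vertex G u * path G w p = (0 : LeavittPathAlgebra K G) := by
  rw [← source_mul_path, ← mul_assoc, vertex_mul_of_ne h, zero_mul]

theorem path_mul_range (w : V) (p : List E) :
    path G w p * vertex G w = path (K := K) G w p := by
  induction p with
  | nil => exact vertex_mul_self w
  | cons e p ih => rw [path, mul_assoc, ih]

theorem path_append (w : V) (p q : List E) :
    path (K := K) G w (p ++ q) = path G (G.pathSource w q) p * path G w q := by
  induction p with
  | nil => exact (source_mul_path w q).symm
  | cons e p ih => rw [List.cons_append, path, path, ih, mul_assoc]

theorem path_cons_eq_zero {w : V} {e : E} {p : List E} (h : G.range e ≠ G.pathSource w p) :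
    path G w (e :: p) = (0 : LeavittPathAlgebra K G) := by
  rw [path, ← edge_mul_range, mul_assoc, vertex_mul_path_of_ne h, mul_zero]

/-- Since `path` accepts every list of edges, a list that fails to compose must be recognised by its
product being zero. -/
theorem isPathTo_of_path_ne_zero {w : V} {p : List E} (h : path (K := K) G w p ≠ 0) :
    G.IsPathTo w p := by
  induction p with
  | nil => trivial
  | cons e p ih =>
    refine ⟨by_contra fun hne => h (path_cons_eq_zero hne), ih fun h0 => h ?_⟩
    rw [path, h0, mul_zero]

/-- The relation `v = ∑ e e*` has a single summand here. -/
theorem edge_mul_ghost_of_unbranched {e : E} (h : G.Unbranched (G.source e)) :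
    edge G e * ghost G e = vertex (K := K) G (G.source e) := by
  have hset : {f : E | G.source f = G.source e} = {e} :=
    Set.eq_singleton_iff_unique_mem.2 ⟨rfl, fun f hf => h.eq_of_source hf rfl⟩
  have hreg : G.IsRegular (G.source e) := ⟨by rw [hset]; exact Set.finite_singleton e, e, rfl⟩
  have : hreg.1.toFinset = {e} := by
    ext f
    rw [Set.Finite.mem_toFinset, hset, Set.mem_singleton_iff, Finset.mem_singleton]
  rw [vertex_eq_sum hreg, this, Finset.sum_singleton]

variable [StarRing K]

theorem star_path_mul_source (w : V) (p : List E) :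
    star (path G w p) * vertex G (G.pathSource w p) = star (path (K := K) G w p) := by
  conv_rhs => rw [← source_mul_path, star_mul, star_vertex]

theorem star_path_mul_self {w : V} {p : List E} (h : G.IsPathTo w p) :
    star (path G w p) * path G w p = vertex (K := K) G w := by
  induction p with
  | nil => rw [path, star_vertex, vertex_mul_self]
  | cons e p ih =>
    rw [path, star_mul, star_edge, mul_assoc, ← mul_assoc (ghost G e), ghost_mul_edge, h.1,
      source_mul_path, ih h.2]

/-- The product `p* q` of paths vanishes unless one of them extends the other. -/
theorem star_path_mul_path (w w' : V) (p q : List E) :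
    star (path G w p) * path G w' q = (0 : LeavittPathAlgebra K G) ∨
      (∃ q', q = p ++ q' ∧ G.pathSource w' q' = w ∧
        star (path G w p) * path G w' q = path (K := K) G w' q') ∨
      ∃ p', p = q ++ p' ∧ G.pathSource w p' = w' ∧
        star (path G w p) * path G w' q = star (path (K := K) G w p') := by
  induction p generalizing q with
  | nil =>
    rw [path, star_vertex]
    by_cases h : w = G.pathSource w' q
    · exact .inr (.inl ⟨q, rfl, h.symm, by rw [h, source_mul_path]⟩)
    · exact .inl (vertex_mul_path_of_ne h)
  | cons e p ih =>
    cases q with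
    | nil =>
      by_cases h : w' = G.pathSource w (e :: p)
      · exact .inr (.inr ⟨e :: p, rfl, h.symm, by
          change _ * vertex G w' = _
          rw [h, star_path_mul_source]⟩)
      · left
        change _ * vertex G w' = 0
        rw [← star_vertex, ← star_mul, vertex_mul_path_of_ne h, star_zero]
    | cons f q =>
      by_cases hef : e = f
      · subst hef
        by_cases h : G.range e = G.pathSource w' q
        · have : star (path G w (e :: p)) * path G w' (e :: q) =
              star (path G w p) * path (K := K) G w' q := by
            rw [path, path, star_mul, star_edge, mul_assoc, ← mul_assoc (ghost G e),
              ghost_mul_edge, h, source_mul_path]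
          rw [this]
          simpa using ih q
        · exact .inl (by rw [path_cons_eq_zero h, mul_zero])
      · left
        rw [path, path, star_mul, star_edge, mul_assoc, ← mul_assoc (ghost G e),
          ghost_mul_edge_of_ne hef, zero_mul, mul_zero]

/-- Every vertex on the path is unbranched, so `e e* = s(e)` collapses the product from the inside.
-/
theorem path_mul_star_of_unbranched {w : V} {p : List E} (h : G.IsPathTo w p)
    (hs : G.Unbranched (G.pathSource w p)) :
    path G w p * star (path G w p) = vertex (K := K) G (G.pathSource w p) := by
  induction p with
  | nil => rw [path, star_vertex, vertex_mul_self, DirGraph.pathSource]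
  | cons e p ih =>
    have h' : G.Unbranched (G.source e) := hs
    rw [path, star_mul, star_edge, mul_assoc, ← mul_assoc (path G w p),
      ih h.2 (h.1 ▸ h'.range), ← h.1, range_mul_ghost, edge_mul_ghost_of_unbranched h',
      DirGraph.pathSource]

variable (K G) in
/-- The elements `p q*` for paths `p` and `q` that end at the same unbranched vertex. -/
def unbranchedMonomials : Set (LeavittPathAlgebra K G) :=
  {a | ∃ w p q, G.Unbranched w ∧ a = path G w p * star (path G w q)}

theorem ofGen_mul_mem_span {g : LPA.Gen V E} {x : LeavittPathAlgebra K G}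
    (hx : x ∈ Submodule.span K (unbranchedMonomials K G)) :
    ofGen G g * x ∈ Submodule.span K (unbranchedMonomials K G) := by
  have hv : ∀ u w p (z : LeavittPathAlgebra K G),
      path G w p * z ∈ Submodule.span K (unbranchedMonomials K G) →
      vertex G u * (path G w p * z) ∈ Submodule.span K (unbranchedMonomials K G) := by
    intro u w p z h
    by_cases hu : u = G.pathSource w p
    · rwa [hu, ← mul_assoc, source_mul_path]
    · rw [← mul_assoc, vertex_mul_path_of_ne hu, zero_mul]
      exact Submodule.zero_mem _
  induction hx using Submodule.span_induction with
  | zero => rw [mul_zero]; exact Submodule.zero_mem _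
  | add x y _ _ hx hy => rw [mul_add]; exact Submodule.add_mem _ hx hy
  | smul k x _ hx => rw [mul_smul_comm]; exact Submodule.smul_mem _ k hx
  | mem x hx =>
    obtain ⟨w, p, q, hw, rfl⟩ := hx
    cases g with
    | vertex u => exact hv u w p _ (Submodule.subset_span ⟨w, p, q, hw, rfl⟩)
    | edge e => exact Submodule.subset_span ⟨w, e :: p, q, hw, by rw [path, mul_assoc]⟩
    | ghost e =>
      cases p with
      | nil =>
        rw [path, ← mul_assoc]
        -- Here `e* q* = (q e)*`; it stays in the set because the range of an edge with unbranched
        -- source is unbranched.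
        by_cases hwe : w = G.source e
        · subst hwe
          refine Submodule.subset_span ⟨G.range e, [], q ++ [e], hw.range, ?_⟩
          rw [path_append, path, path, path, DirGraph.pathSource, edge_mul_range, star_mul,
            star_edge, ghost_mul_source, ← mul_assoc, range_mul_ghost]
        · change ghost G e * vertex G w * _ ∈ _
          rw [← ghost_mul_source, mul_assoc (ghost G e), vertex_mul_of_ne (Ne.symm hwe), mul_zero,
            zero_mul]
          exact Submodule.zero_mem _
      | cons f p =>
        rw [path, mul_assoc, ← mul_assoc]
        by_cases hef : e = f
        · rw [hef, ghost_mul_edge]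
          exact hv _ w p _ (Submodule.subset_span ⟨w, p, q, hw, rfl⟩)
        · rw [ghost_mul_edge_of_ne hef, zero_mul]
          exact Submodule.zero_mem _

theorem star_mem_span {x : LeavittPathAlgebra K G}
    (hx : x ∈ Submodule.span K (unbranchedMonomials K G)) :
    star x ∈ Submodule.span K (unbranchedMonomials K G) := by
  induction hx using Submodule.span_induction with
  | zero => rw [star_zero]; exact Submodule.zero_mem _
  | add x y _ _ hx hy => rw [star_add]; exact Submodule.add_mem _ hx hy
  | smul k x _ hx => rw [star_smul]; exact Submodule.smul_mem _ _ hx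
  | mem x hx =>
    obtain ⟨w, p, q, hw, rfl⟩ := hx
    exact Submodule.subset_span ⟨w, q, p, hw, by rw [star_mul, star_star]⟩

/-- For branched `u`, expand `u = ∑ f f*`. By induction `r(f)` lies in the span, hence so do `f = f
r(f)`, its adjoint `f*`, and `f f*`. -/
theorem vertex_mem_span (hrow : G.RowFinite) (hwf : WellFounded G.BranchedStep) (u : V) :
    vertex G u ∈ Submodule.span K (unbranchedMonomials K G) := by
  induction u using hwf.induction with
  | _ u ih =>
    by_cases hu : G.Unbranched u
    · exact Submodule.subset_span
        ⟨u, [], [], hu, by rw [path, star_vertex, vertex_mul_self]⟩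
    · obtain ⟨e, rfl⟩ := DirGraph.exists_source_of_not_unbranched hu
      rw [vertex_eq_sum (hrow.isRegular e)]
      refine Submodule.sum_mem _ fun f hf => ofGen_mul_mem_span ?_
      rw [← star_edge, ← edge_mul_range]
      exact star_mem_span (ofGen_mul_mem_span
        (ih _ ⟨hu, f, (hrow.isRegular e).1.mem_toFinset.1 hf, rfl⟩))

theorem span_unbranchedMonomials (hrow : G.RowFinite) (hwf : WellFounded G.BranchedStep) :
    Submodule.span K (unbranchedMonomials K G) = ⊤ := by
  refine eq_top_of_ofGen_mul_mem _ (fun g => ?_) fun g x hx => ofGen_mul_mem_span hx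
  have hv := vertex_mem_span (K := K) hrow hwf
  cases g with
  | vertex u => exact hv u
  | edge e =>
    change edge G e ∈ _
    rw [← edge_mul_range]
    exact ofGen_mul_mem_span (hv _)
  | ghost e =>
    change ghost G e ∈ _
    rw [← ghost_mul_source]
    exact ofGen_mul_mem_span (hv _)

end LeavittPathAlgebra

/-! ### Orthonormality of the spanning elements -/

namespace BranchingSystem

open LeavittPathAlgebra

variable {K : Type u} [Field K] {V : Type v} {E : Type w} {G : DirGraph V E} {X : Type*}
  (S : BranchingSystem G X)

theorem isMonomial_path (w : V) (p : List E) :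
    IsMonomial (p.length : ℤ) (S.rep K (path G w p)) := by
  induction p with
  | nil => exact S.isMonomial_vertex w
  | cons e p ih =>
    rw [path, map_mul, List.length_cons, Nat.cast_add, add_comm, Nat.cast_one]
    exact (S.isMonomial_edge e).mul ih

variable [StarRing K]

theorem isMonomial_star_path (w : V) (p : List E) :
    IsMonomial (-(p.length : ℤ)) (S.rep K (star (path G w p))) := by
  induction p with
  | nil => rw [path, star_vertex]; exact S.isMonomial_vertex w
  | cons e p ih =>
    rw [path, star_mul, star_edge, map_mul, List.length_cons, Nat.cast_add, neg_add, Nat.cast_one]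
    exact ih.mul (S.isMonomial_ghost e)

variable (hfin : ∀ v, {x | S.base x = v}.Finite)

/-- After cyclic permutation, `q* p` is zero, a nonempty path or the adjoint of one; the latter two
have nonzero degree in `T`. -/
theorem trace_path_mul_star_of_ne {w w' : V} {p q : List E} (hpq : p ≠ q) :
    S.trace hfin (path (K := K) G w p * star (path G w' q)) = 0 := by
  rw [trace_mul_comm]
  obtain h | ⟨q', h, -, h'⟩ | ⟨p', h, -, h'⟩ := star_path_mul_path (K := K) (G := G) w' w q p
  · rw [h, map_zero]
  · rw [h']
    refine S.trace_of_isMonomial hfin (n := q'.length) ?_ (S.isMonomial_path w q')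
    rintro h0
    obtain rfl : q' = [] := by simpa using h0
    exact hpq (by simpa using h)
  · rw [h']
    refine S.trace_of_isMonomial hfin (n := -p'.length) ?_ (S.isMonomial_star_path w' p')
    rintro h0
    obtain rfl : p' = [] := by simpa using h0
    exact hpq (by simpa using h.symm)

theorem trace_path_mul_star_self
    (huniq : ∀ v, G.Unbranched v → ∃ x, S.base x = v ∧ ∀ y, S.base y = v → y = x)
    {w : V} (hw : G.Unbranched w) {p : List E} (hp : G.IsPathTo w p) :
    S.trace hfin (path (K := K) G w p * star (path G w p)) = 1 := by
  obtain ⟨x, rfl, hx⟩ := huniq w hw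
  rw [trace_mul_comm, star_path_mul_self hp, S.trace_vertex hfin hx]

/-- The nonzero elements `p q*`, for paths `p` and `q` that end at the same unbranched vertex, are
orthonormal with respect to the trace. -/
theorem trace_mul_star_self
    (huniq : ∀ v, G.Unbranched v → ∃ x, S.base x = v ∧ ∀ y, S.base y = v → y = x)
    {a : LeavittPathAlgebra K G} (ha : a ∈ unbranchedMonomials K G) (ha0 : a ≠ 0) :
    S.trace hfin (a * star a) = 1 := by
  obtain ⟨w, p, q, hw, rfl⟩ := ha
  have hp : G.IsPathTo w p := isPathTo_of_path_ne_zero (K := K) fun h => ha0 (by rw [h, zero_mul])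
  have hq : G.IsPathTo w q := isPathTo_of_path_ne_zero (K := K) fun h => ha0 (by
    rw [h, star_zero, mul_zero])
  rw [star_mul, star_star, mul_assoc, ← mul_assoc (star (path G w q)), star_path_mul_self hq,
    ← mul_assoc, path_mul_range, S.trace_path_mul_star_self hfin huniq hw hp]

theorem trace_mul_star_of_ne {a b : LeavittPathAlgebra K G} (ha : a ∈ unbranchedMonomials K G)
    (hb : b ∈ unbranchedMonomials K G) (ha0 : a ≠ 0) (hb0 : b ≠ 0) (hab : a ≠ b) :
    S.trace hfin (a * star b) = 0 := by
  obtain ⟨w, p, q, hw, rfl⟩ := ha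
  obtain ⟨w', r, s, hw', rfl⟩ := hb
  have hq : G.IsPathTo w q := isPathTo_of_path_ne_zero (K := K) fun h => ha0 (by
    rw [h, star_zero, mul_zero])
  have hs : G.IsPathTo w' s := isPathTo_of_path_ne_zero (K := K) fun h => hb0 (by
    rw [h, star_zero, mul_zero])
  rw [star_mul, star_star, mul_assoc, ← mul_assoc (star (path G w q))]
  obtain h | ⟨s', rfl, rfl, h⟩ | ⟨q', rfl, rfl, h⟩ :=
    star_path_mul_path (K := K) (G := G) w w' q s
  · rw [h, zero_mul, mul_zero, map_zero]
  · rw [h, ← mul_assoc, ← path_append]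
    -- The trace is that of `(p s') r*`. If `r = p s'`, then `b = p s' s'* q* = p q* = a`, as `s'`
    -- starts at the unbranched vertex where `q` ends.
    refine S.trace_path_mul_star_of_ne hfin fun hr => hab ?_
    rw [← hr, path_append, path_append, star_mul, mul_assoc, ← mul_assoc (path G w' s'),
      path_mul_star_of_unbranched (DirGraph.isPathTo_append.1 hs).2 hw, ← mul_assoc,
      path_mul_range]
  · rw [h, ← star_mul, ← path_append]
    refine S.trace_path_mul_star_of_ne hfin fun hp => hab ?_
    rw [hp, path_append, path_append, star_mul, mul_assoc, ← mul_assoc (path G w q'),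
      path_mul_star_of_unbranched (DirGraph.isPathTo_append.1 hq).2 hw', ← mul_assoc,
      path_mul_range]

end BranchingSystem

/-! ### Positive elements and the faithful trace into `K` -/

theorem IsPositiveElement.mul_star {R : Type*} [NonUnitalRing R] [StarRing R] (y : R) :
    IsPositiveElement (y * star y) :=
  AddSubmonoid.subset_closure ⟨y, rfl⟩

theorem IsPositiveElement.zero {R : Type*} [NonUnitalRing R] [StarRing R] :
    IsPositiveElement (0 : R) :=
  AddSubmonoid.zero_mem _

theorem IsPositiveElement.add {R : Type*} [NonUnitalRing R] [StarRing R] {x y : R}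
    (hx : IsPositiveElement x) (hy : IsPositiveElement y) : IsPositiveElement (x + y) :=
  AddSubmonoid.add_mem _ hx hy

theorem IsPositiveElement.sum {R ι : Type*} [NonUnitalRing R] [StarRing R] {s : Finset ι}
    {f : ι → R} (h : ∀ i ∈ s, IsPositiveElement (f i)) : IsPositiveElement (∑ i ∈ s, f i) :=
  AddSubmonoid.sum_mem _ h

theorem IsPositiveElement.exists_fin {R : Type*} [NonUnitalRing R] [StarRing R] {x : R}
    (hx : IsPositiveElement x) : ∃ (n : ℕ) (y : Fin n → R), x = ∑ i, y i * star (y i) := by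
  induction hx using AddSubmonoid.closure_induction with
  | mem x hx =>
    obtain ⟨y, rfl⟩ := hx
    exact ⟨1, fun _ => y, by simp⟩
  | zero => exact ⟨0, Fin.elim0, by simp⟩
  | add x y _ _ hx hy =>
    obtain ⟨m, f, rfl⟩ := hx
    obtain ⟨n, g, rfl⟩ := hy
    exact ⟨m + n, Fin.append f g, by simp [Fin.sum_univ_add]⟩

theorem IsPositiveElement.star_eq {R : Type*} [NonUnitalRing R] [StarRing R] {x : R}
    (hx : IsPositiveElement x) : star x = x := by
  obtain ⟨n, y, rfl⟩ := hx.exists_fin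
  simp [star_sum]

theorem IsPosDefInvolution.eq_zero_of_add_eq_zero {R : Type*} [NonUnitalRing R] [StarRing R]
    (hR : IsPosDefInvolution R) {x y : R} (hx : IsPositiveElement x) (hy : IsPositiveElement y)
    (h : x + y = 0) : x = 0 := by
  obtain ⟨m, f, rfl⟩ := hx.exists_fin
  obtain ⟨n, g, rfl⟩ := hy.exists_fin
  have := hR (m + n) (Fin.append f g) (by simpa [Fin.sum_univ_add] using h)
  refine Finset.sum_eq_zero fun i _ => ?_
  have hi := this (Fin.castAdd n i)
  rw [Fin.append_left] at hi
  rw [hi, zero_mul]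

/-- A trace is faithful if it maps each `y y*` to a positive element that is nonzero unless
`y = 0`. -/
theorem IsTrace.isFaithfulTrace {R T : Type*} [NonUnitalRing R] [StarRing R] [NonUnitalRing T]
    [StarRing T] (hT : IsPosDefInvolution T) {t : R → T} (ht : IsTrace t)
    (hpos : ∀ y, IsPositiveElement (t (y * star y)))
    (hzero : ∀ y, t (y * star y) = 0 → y = 0) : IsFaithfulTrace t := by
  have key : ∀ x, IsPositiveElement x → IsPositiveElement (t x) ∧ (t x = 0 → x = 0) := by
    intro x hx
    induction hx using AddSubmonoid.closure_induction with
    | mem x hx =>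
      obtain ⟨y, rfl⟩ := hx
      exact ⟨hpos y, fun h => by simp [hzero y h]⟩
    | zero =>
      have : t 0 = 0 := by simpa using ht.map_add 0 0
      exact ⟨this ▸ .zero, fun _ => rfl⟩
    | add x y _ _ hx hy =>
      rw [ht.map_add]
      refine ⟨hx.1.add hy.1, fun h => ?_⟩
      rw [hx.2 (hT.eq_zero_of_add_eq_zero hx.1 hy.1 h),
        hy.2 (hT.eq_zero_of_add_eq_zero hy.1 hx.1 (by rwa [add_comm])), add_zero]
  exact ⟨ht, fun x hx hx0 => ⟨(key x hx).1, fun h => hx0 ((key x hx).2 h)⟩⟩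

theorem LeavittPathAlgebra.exists_isFaithfulTrace {K : Type u} [Field K] [StarRing K]
    (hK : IsPosDefInvolution K) {V : Type v} {E : Type w} {G : DirGraph V E}
    (hrow : G.RowFinite) (hwf : WellFounded G.BranchedStep) :
    ∃ t : LeavittPathAlgebra K G → K, IsFaithfulTrace t ∧ IsScalarLinear K t := by
  obtain ⟨X, S, hfin, huniq⟩ := DirGraph.exists_branchingSystem hrow hwf
  have hexp : ∀ y : LeavittPathAlgebra K G, ∃ c : LeavittPathAlgebra K G →₀ K,
      y = ∑ a ∈ c.support, c a • a ∧
        S.trace hfin (y * star y) = ∑ a ∈ c.support, c a * star (c a) := by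
    intro y
    -- Zero is discarded, since orthonormality only holds among nonzero elements.
    have hy : y ∈ Submodule.span K (unbranchedMonomials K G \ {0}) := by
      rw [Submodule.span_sdiff_singleton_zero, span_unbranchedMonomials hrow hwf]
      exact Submodule.mem_top
    obtain ⟨c, hc, rfl⟩ := Submodule.mem_span_set.1 hy
    refine ⟨c, rfl, ?_⟩
    rw [Finsupp.sum, star_sum, Finset.sum_mul_sum, map_sum]
    refine Finset.sum_congr rfl fun a ha => ?_
    rw [map_sum, Finset.sum_eq_single a]
    · rw [star_smul, smul_mul_smul_comm, map_smul,
        S.trace_mul_star_self hfin huniq (hc ha).1 (hc ha).2, smul_eq_mul, mul_one]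
    · intro b hb hne
      rw [star_smul, smul_mul_smul_comm, map_smul,
        S.trace_mul_star_of_ne hfin (hc ha).1 (hc hb).1 (hc ha).2 (hc hb).2 hne.symm, smul_zero]
    · exact fun h => absurd ha h
  refine ⟨S.trace hfin, IsTrace.isFaithfulTrace hK ⟨map_add _, S.trace_mul_comm hfin⟩ ?_ ?_,
    map_smul (S.trace hfin)⟩
  · intro y
    obtain ⟨c, -, h⟩ := hexp y
    rw [h]
    exact .sum fun a _ => .mul_star _
  · intro y hy
    obtain ⟨c, rfl, h⟩ := hexp y
    rw [h] at hy
    refine Finset.sum_eq_zero fun a ha => ?_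
    classical
    -- A sum of positive elements vanishes only if each does, so one coefficient at a time is split
    -- off.
    rw [← Finset.add_sum_erase _ _ ha] at hy
    have := hK.eq_zero_of_add_eq_zero (.mul_star _) (.sum fun b _ => .mul_star _) hy
    rw [hK 1 (fun _ => c a) (by simpa using this) 0, zero_smul]

/-! ### Cycles with exits exclude faithful traces -/

namespace LeavittPathAlgebra

/-- If a cycle has an exit, then no trace on the Leavitt path algebra is faithful. -/
theorem noExit_of_isFaithfulTrace {K : Type u} [Field K] [StarRing K] {V : Type v} {E : Type w}
    {G : DirGraph V E} (hrow : G.RowFinite) {T : Type*} [NonUnitalRing T] [StarRing T]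
    {t : LeavittPathAlgebra K G → T} (ht : IsFaithfulTrace t) : G.NoExit := by
  rintro p ⟨hchain, ⟨hne, hclosed⟩, -⟩ f ⟨g, hg, hs, hfg⟩
  have hp := DirGraph.isPathTo_of_isChain hchain hne
  have hsrc : G.pathSource (G.range (p.getLast hne)) p = G.range (p.getLast hne) := by
    rw [hclosed]
    cases p with
    | nil => exact absurd rfl hne
    | cons e p => rfl
  generalize G.range (p.getLast hne) = v at hp hsrc
  set π : LeavittPathAlgebra K G := path G v p
  have hπ : star π * π = vertex G v := star_path_mul_self hp
  have hvπ : vertex G v * π = π := by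
    conv_lhs => rw [← hsrc]
    exact source_mul_path v p
  have hπv : star π * vertex G v = star π := by
    conv_rhs => rw [← hvπ, star_mul, star_vertex]
  have hπ' : π * vertex G v = π := path_mul_range v p
  -- The element is a self-adjoint idempotent, hence positive.
  have hx : (vertex G v - π * star π) * star (vertex G v - π * star π) =
      vertex G v - π * star π := by
    rw [star_sub, star_mul, star_star, star_vertex, sub_mul, mul_sub, mul_sub, vertex_mul_self,
      ← mul_assoc, hvπ, mul_assoc, hπv, mul_assoc, ← mul_assoc (star π) π, hπ, ← mul_assoc π,
      hπ', sub_self, sub_zero]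
  have h0 : t (vertex G v - π * star π) = 0 := by
    have h1 := ht.1.map_add (vertex G v - π * star π) (π * star π)
    rw [sub_add_cancel, ht.1.map_mul_comm π, hπ] at h1
    simpa using h1
  have hzero : vertex G v = π * star π := by
    by_contra hne'
    exact (ht.2 _ (hx ▸ .mul_star _) (sub_ne_zero.2 hne')).2 h0
  obtain ⟨p₁, p₂, rfl⟩ := List.append_of_mem hg
  have hp₁ : G.IsPathTo (G.range f) (p₁ ++ [f]) :=
    DirGraph.isPathTo_append.2 ⟨by
      change G.IsPathTo (G.source f) p₁
      rw [hs]
      exact (DirGraph.isPathTo_append.1 hp).1, rfl, trivial⟩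
  -- This path follows the cycle to the exit `f` and then leaves along it.
  set y : LeavittPathAlgebra K G := path G (G.range f) (p₁ ++ [f])
  have hvy : vertex G v * y = y := by
    have : G.pathSource (G.range f) (p₁ ++ [f]) = v := by
      rw [← hsrc, DirGraph.pathSource_append, DirGraph.pathSource_append]
      exact congrArg (fun u => G.pathSource u p₁) hs
    conv_lhs => rw [← this]
    exact source_mul_path _ _
  -- As `f ≠ g` after the common part `p₁`, neither path extends the other.
  have hπy : star π * y = 0 := by
    obtain h | ⟨q, h, -⟩ | ⟨q, h, -⟩ :=
      star_path_mul_path (K := K) (G := G) v (G.range f) (p₁ ++ g :: p₂) (p₁ ++ [f])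
    · exact h
    · simp_all
    · simp_all
  have hy0 : y = 0 := by rw [← hvy, hzero, mul_assoc, hπy, mul_zero]
  refine vertex_ne_zero K hrow (G.range f) ?_
  rw [← star_path_mul_self hp₁]
  change star y * y = 0
  rw [hy0, mul_zero]

end LeavittPathAlgebra

/-! ### The universal trace and its involution -/

section MinimalTrace

variable {K : Type u} [Field K] {A : Type v} [NonUnitalRing A] [Module K A] [IsScalarTower K A A]
  [SMulCommClass K A A]

variable (K A) in
/-- The additive subgroup generated by the commutators, as a subspace. -/
def commutatorSubmodule : Submodule K A where
  __ := commutatorAddSubgroup A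
  smul_mem' k x hx := by
    change x ∈ commutatorAddSubgroup A at hx
    change k • x ∈ commutatorAddSubgroup A
    induction hx using AddSubgroup.closure_induction with
    | mem x hx =>
      obtain ⟨a, b, rfl⟩ := hx
      exact AddSubgroup.subset_closure
        ⟨k • a, b, by rw [smul_sub, smul_mul_assoc, mul_smul_comm]⟩
    | zero => rw [smul_zero]; exact AddSubgroup.zero_mem _
    | add x y _ _ hx hy => rw [smul_add]; exact AddSubgroup.add_mem _ hx hy
    | neg x _ hx => rw [smul_neg]; exact AddSubgroup.neg_mem _ hx

theorem star_mem_commutatorAddSubgroup [StarRing A] {x : A} (hx : x ∈ commutatorAddSubgroup A) :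
    star x ∈ commutatorAddSubgroup A := by
  induction hx using AddSubgroup.closure_induction with
  | mem x hx =>
    obtain ⟨a, b, rfl⟩ := hx
    exact AddSubgroup.subset_closure
      ⟨star b, star a, by rw [star_sub, star_mul, star_mul]⟩
  | zero => rw [star_zero]; exact AddSubgroup.zero_mem _
  | add x y _ _ hx hy => rw [star_add]; exact AddSubgroup.add_mem _ hx hy
  | neg x _ hx => rw [star_neg]; exact AddSubgroup.neg_mem _ hx

variable (K A) in
/-- The quotient `A / [A, A]`, lifted to a higher universe. -/
abbrev CommutatorQuotient : Type (max v z) := ULift.{z} (A ⧸ commutatorSubmodule K A)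

namespace CommutatorQuotient

variable (K) in
/-- The universal trace `A → A / [A, A]`. -/
def proj : A →ₗ[K] CommutatorQuotient.{u, v, z} K A :=
  ULift.moduleEquiv.symm.toLinearMap ∘ₗ (commutatorSubmodule K A).mkQ

theorem proj_surjective : Function.Surjective (proj (A := A) K) :=
  ULift.moduleEquiv.symm.surjective.comp (Submodule.mkQ_surjective _)

theorem proj_eq_zero_iff {x : A} : proj K x = 0 ↔ x ∈ commutatorAddSubgroup A := by
  rw [proj, LinearMap.comp_apply, LinearEquiv.coe_coe, LinearEquiv.map_eq_zero_iff,
    Submodule.mkQ_apply, Submodule.Quotient.mk_eq_zero]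
  rfl

theorem proj_mul_comm (x y : A) : proj K (x * y) = proj K (y * x) := by
  rw [← sub_eq_zero, ← map_sub, proj_eq_zero_iff]
  exact AddSubgroup.subset_closure ⟨x, y, rfl⟩

variable [StarRing K] [StarRing A] [StarModule K A]

/-- The involution descends because it preserves `[A, A]`. -/
noncomputable instance : Star (CommutatorQuotient.{u, v, z} K A) where
  star m := ⟨(commutatorSubmodule K A).mapQ (commutatorSubmodule K A)
    (starLinearEquiv K : A ≃ₗ⋆[K] A).toLinearMap
    (fun _ hx => star_mem_commutatorAddSubgroup hx) m.down⟩

theorem star_proj (x : A) : star (proj K x) = proj K (star x) := rfl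

noncomputable instance : StarAddMonoid (CommutatorQuotient.{u, v, z} K A) where
  star_involutive m := by
    obtain ⟨x, rfl⟩ := proj_surjective m
    rw [star_proj, star_proj, star_star]
  star_add m n := by
    obtain ⟨x, rfl⟩ := proj_surjective m
    obtain ⟨y, rfl⟩ := proj_surjective n
    rw [← map_add, star_proj, star_add, map_add, ← star_proj, ← star_proj]

instance : StarModule K (CommutatorQuotient.{u, v, z} K A) where
  star_smul k m := by
    obtain ⟨x, rfl⟩ := proj_surjective m
    rw [← map_smul, star_proj, star_smul, map_smul, ← star_proj]

/-- Scalars of the commutative field act from the right as from the left. -/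
instance : Module Kᵐᵒᵖ (CommutatorQuotient.{u, v, z} K A) :=
  Module.compHom _ (RingHom.fromOpposite (RingHom.id K) fun _ _ => mul_comm _ _)

instance : IsCentralScalar K (CommutatorQuotient.{u, v, z} K A) := ⟨fun _ _ => rfl⟩

end CommutatorQuotient

end MinimalTrace

/-! ### Square-zero extensions and minimal faithful traces -/

namespace TrivSqZeroExt

variable {K : Type u} [Field K] [StarRing K] {M : Type v} [AddCommGroup M] [Module K M]
  [Module Kᵐᵒᵖ M] [IsCentralScalar K M] [StarAddMonoid M] [StarModule K M]

/-- The componentwise involution of a trivial square-zero extension. -/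
instance instStarRingOfStarModule : StarRing (TrivSqZeroExt K M) where
  star x := (star x.fst, star x.snd)
  star_involutive x := by
    ext
    · exact star_star x.fst
    · exact star_star x.snd
  star_add x y := by
    ext
    · exact star_add x.fst y.fst
    · exact star_add x.snd y.snd
  star_mul x y := by
    ext
    · exact star_mul x.fst y.fst
    · change star (x * y).snd =
        star y.fst • star x.snd + MulOpposite.op (star x.fst) • star y.snd
      rw [snd_mul, op_smul_eq_smul, op_smul_eq_smul, star_add, star_smul, star_smul, add_comm]

theorem fst_star (x : TrivSqZeroExt K M) : (star x).fst = star x.fst := rfl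

theorem snd_star (x : TrivSqZeroExt K M) : (star x).snd = star x.snd := rfl

/-- A self-adjoint element of a trivial square-zero extension is positive if its scalar part is
positive and nonzero. -/
theorem isPositiveElement_of_fst (h2 : (2 : K) ≠ 0) {x : TrivSqZeroExt K M}
    (hpos : IsPositiveElement x.fst) (h0 : x.fst ≠ 0) (hstar : star x.snd = x.snd) :
    IsPositiveElement x := by
  have hinl : ∀ c : K, IsPositiveElement c → IsPositiveElement (inl c : TrivSqZeroExt K M) := by
    intro c hc
    obtain ⟨n, y, rfl⟩ := hc.exists_fin
    have : (inl (∑ i, y i * star (y i)) : TrivSqZeroExt K M) =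
        ∑ i, inl (y i) * star (inl (y i)) := by
      rw [← inlHom_apply, map_sum]
      refine Finset.sum_congr rfl fun i _ => ?_
      ext
      · simp [fst_star]
      · simp [fst_star, snd_star]
    rw [this]
    exact .sum fun i _ => .mul_star _
  obtain ⟨n, y, hy⟩ := hpos.exists_fin
  obtain ⟨i, -, hi⟩ := Finset.exists_ne_zero_of_sum_ne_zero (hy ▸ h0)
  have hyi : y i ≠ 0 := left_ne_zero_of_mul hi
  have hyi' : star (y i) ≠ 0 := right_ne_zero_of_mul hi
  -- The coefficient is chosen so that `b * star b` has second component `(1/2 + 1/2) • x.snd`; the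
  -- two halves come from the cross terms, and `x.snd` is self-adjoint.
  let b : TrivSqZeroExt K M := inl (y i) + inr ((2 * star (y i))⁻¹ • x.snd)
  have hx : x = b * star b + inl (∑ j ∈ Finset.univ.erase i, y j * star (y j)) := by
    ext
    · simp [b, fst_star, hy]
    · have h1 : y i * (2 * y i)⁻¹ = 2⁻¹ := by field_simp
      have h1' : star (y i) * (2 * star (y i))⁻¹ = 2⁻¹ := by field_simp
      have h3 : (2⁻¹ + 2⁻¹ : K) = 1 := by field_simp; norm_num
      have h4 : star ((2 * star (y i))⁻¹) = (2 * y i)⁻¹ := by simp [mul_comm]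
      simp only [snd_add, snd_mul, snd_inl, add_zero, b, fst_star, snd_star, fst_add, fst_inl,
        fst_inr, snd_inr, zero_add, op_smul_eq_smul, star_smul, hstar, smul_smul, h4, h1, h1']
      rw [← add_smul, h3, one_smul]
  rw [hx]
  exact (IsPositiveElement.mul_star b).add (hinl _ (.sum fun j _ => .mul_star _))

end TrivSqZeroExt

/-- In characteristic two, `1 * star 1 + 1 * star 1` would vanish. -/
theorem IsPosDefInvolution.two_ne_zero {K : Type*} [Field K] [StarRing K]
    (hK : IsPosDefInvolution K) : (2 : K) ≠ 0 := by
  intro h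
  refine one_ne_zero (α := K) (hK 2 (fun _ => 1) ?_ 0)
  simpa using h

/-- A faithful linear trace `t : A → K` can be combined with the universal trace `A → A / [A, A]`
to a faithful minimal trace: its values lie in the commutative `K`-algebra `K ⊕ A / [A, A]`, in
which `A / [A, A]` is an ideal of square zero and the involution acts componentwise. A
self-adjoint element `(c, m)` of this algebra with `c > 0` is positive, as `K` has
characteristic different from two. -/
theorem exists_isMinimalTrace {K : Type u} [Field K] [StarRing K] (hK : IsPosDefInvolution K)
    {A : Type v} [NonUnitalRing A] [Module K A] [IsScalarTower K A A] [SMulCommClass K A A]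
    [StarRing A] [StarModule K A] {t : A → K} (ht : IsFaithfulTrace t)
    (hlin : IsScalarLinear K t) :
    ∃ s : A → TrivSqZeroExt K (CommutatorQuotient.{u, v, z} K A),
      IsFaithfulTrace s ∧ IsScalarLinear K s ∧ IsMinimalTrace s := by
  let s : A → TrivSqZeroExt K (CommutatorQuotient.{u, v, z} K A) := fun x =>
    .inl (t x) + .inr (CommutatorQuotient.proj K x)
  have hfst : ∀ x, (s x).fst = t x := fun x => by simp [s]
  have hsnd : ∀ x, (s x).snd = CommutatorQuotient.proj K x := fun x => by simp [s]
  have hs : IsTrace s := by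
    refine ⟨fun x y => ?_, fun x y => ?_⟩
    · ext
      · simp [hfst, ht.1.map_add]
      · simp [hsnd]
    · ext
      · simp [hfst, ht.1.map_mul_comm x y]
      · simp [hsnd, CommutatorQuotient.proj_mul_comm x y]
  refine ⟨s, ⟨hs, fun x hx hx0 => ?_⟩, fun c x => ?_, hs, fun x hx => ?_⟩
  · obtain ⟨h1, h2⟩ := ht.2 x hx hx0
    refine ⟨TrivSqZeroExt.isPositiveElement_of_fst hK.two_ne_zero ((hfst x).symm ▸ h1)
      ((hfst x).symm ▸ h2) ?_, fun h => h2 ?_⟩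
    -- Positive elements are self-adjoint, so their classes modulo commutators are too.
    · rw [hsnd, CommutatorQuotient.star_proj, hx.star_eq]
    · rw [← hfst, h, TrivSqZeroExt.fst_zero]
  · ext
    · simp [hfst, hlin c x]
    · simp [hsnd]
  · rw [← CommutatorQuotient.proj_eq_zero_iff (K := K), ← hsnd, hx, TrivSqZeroExt.snd_zero]

/-! ### The equivalence -/

theorem mainTheorem1 {K : Type u} [Field K] [StarRing K]
    (hK : IsPosDefInvolution K)
    {V : Type v} {E : Type w} (G : DirGraph V E) (hrow : G.RowFinite)
    (hinf : ∀ f : ℕ → E, G.IsInfinitePath f → G.EndsInSink f ∨ G.EndsInCycle f) :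
    List.TFAE [
      ∃ t : LeavittPathAlgebra K G → K, IsFaithfulTrace t ∧ IsScalarLinear K t,
      ∃ (R : Type (max u v w z)) (_ : NonUnitalRing R) (_ : StarRing R) (_ : Module K R)
        (_ : IsScalarTower K R R) (_ : SMulCommClass K R R) (t : LeavittPathAlgebra K G → R),
        IsFaithfulTrace t ∧ IsScalarLinear K t,
      ∃ (R : Type (max u v w z)) (_ : NonUnitalRing R) (_ : StarRing R) (_ : Module K R)
        (_ : IsScalarTower K R R) (_ : SMulCommClass K R R) (t : LeavittPathAlgebra K G → R),
        IsFaithfulTrace t ∧ IsScalarLinear K t ∧ IsMinimalTrace t,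
      ∃ (R : Type (max u v w z)) (_ : NonUnitalRing R) (_ : StarRing R)
        (t : LeavittPathAlgebra K G → R), IsFaithfulTrace t ∧ IsMinimalTrace t,
      ∃ (R : Type (max u v w z)) (_ : NonUnitalRing R) (_ : StarRing R)
        (t : LeavittPathAlgebra K G → R), IsFaithfulTrace t,
      G.NoExit] := by
  tfae_have 6 → 1 := fun hG =>
    LeavittPathAlgebra.exists_isFaithfulTrace hK hrow (DirGraph.wellFounded_branchedStep hG hinf)
  tfae_have 1 → 3 := by
    rintro ⟨t, ht, hlin⟩
    -- The universe `z` enters through the lifted commutator quotient and brings the target algebra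
    -- into the required universe.
    obtain ⟨s, h1, h2, h3⟩ := exists_isMinimalTrace.{u, max u v w, z} hK ht hlin
    exact ⟨_, inferInstance, inferInstance, inferInstance, inferInstance, inferInstance, s,
      h1, h2, h3⟩
  tfae_have 3 → 2 := by
    rintro ⟨R, _, _, _, _, _, t, h1, h2, -⟩
    exact ⟨R, _, _, _, ‹_›, ‹_›, t, h1, h2⟩
  tfae_have 3 → 4 := by
    rintro ⟨R, _, _, _, _, _, t, h1, -, h3⟩
    exact ⟨R, _, _, t, h1, h3⟩
  tfae_have 2 → 5 := by
    rintro ⟨R, _, _, _, _, _, t, h1, -⟩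
    exact ⟨R, _, _, t, h1⟩
  tfae_have 4 → 5 := by
    rintro ⟨R, _, _, t, h1, -⟩
    exact ⟨R, _, _, t, h1⟩
  tfae_have 5 → 6 := by
    rintro ⟨R, _, _, t, ht⟩
    exact LeavittPathAlgebra.noExit_of_isFaithfulTrace hrow ht
  tfae_finish
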